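/- Let $\mathbb Z_+=\{1,2,\dots\}$ and let $a(n)$ $(n\ge 0)$ and $b(n)$ $(n\ge 1)$ be real numbers with $a(n)\neq 0$ for all $n$, $a(0)=1$ and $\sum_{n\ge 1}|a(n)|^{-1}=\infty$. Let $H_+$ be the self-adjoint operator on $\ell^2(\mathbb Z_+)$ given by $$(H_+u)(n)=a(n)u(n+1)+a(n-1)u(n-1)+b(n)u(n),\qquad n\ge 1,\quad u(0)=0,$$ with domain all $u\in\ell^2(\mathbb Z_+)$ for which the right-hand side is in $\ell^2(\mathbb Z_+)$. Let $\mu^+$ be its spectral measure at $\delta_1$, i.e. the finite Borel measure on $\mathbb R$ with $\langle (H_+-z)^{-1}\delta_1,\delta_1\rangle=\int_{\mathbb R}\frac{d\mu^+(x)}{x-z}$ for all $z\in\mathbb C\setminus\mathbb R$. For $\varphi:\mathbb Z_+\to\mathbb C$ and $L\ge 0$ put $$\|\varphi\|_L^2=\sum_{n=1}^{\lfloor L\rfloor}|\varphi(n)|^2+(L-\lfloor L\rfloor)|\varphi(\lfloor L\rfloor+1)|^2,$$ and for $T>0$ put $\langle A(t)\rangle_T=\frac2T\int_0^\infty e^{-2t/T}A(t)\,dt$.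 For $E\in\mathbb R$ let $u_\theta(n,E)$, $n\ge 0$, be the solution of $a(n)u(n+1)+a(n-1)u(n-1)+b(n)u(n)=Eu(n)$ $(n\ge1)$ with $u_\theta(0,E)=\sin\theta$, $u_\theta(1,E)=\cos\theta$. Let $$\Phi(n,E)=\begin{pmatrix}u_0(n+1,E)&u_{\pi/2}(n+1,E)\\u_0(n,E)&u_{\pi/2}(n,E)\end{pmatrix},$$ let $\|\Phi(n,E)\|$ be its operator norm, and for $L\ge 1$ let $$\|\Phi(E)\|_L^2=\sum_{n=1}^{\lfloor L\rfloor-1}\|\Phi(n,E)\|^2+(L-\lfloor L\rfloor)\|\Phi(\lfloor L\rfloor,E)\|^2 .$$ For $\epsilon>0$ let $\tilde L^+_\epsilon(E)$ be the unique $L\ge 1$ with $\|\Phi(E)\|_L=2\|\Phi(1,E)^{-1}\|\,\epsilon^{-1}$. Then there is a universal constant $C>0$ (independent of $a$, $b$, $T$ and $L$) such that for all $T>0$ and $L\ge 2$, $$\big\langle\|e^{-iH_+t}\delta_1\|_L^2\big\rangle_T> C\,\mu^+\big(\{E\in\mathbb R:\ \tilde L^+_{T^{-1}}(E)\le L\}\big).$$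 -/

import Mathlib

noncomputable section

namespace JacobiDyn

open MeasureTheory

/-! ## Unbounded self-adjoint operators on a Hilbert space -/

section Abstract

variable {E : Type*} [NormedAddCommGroup E] [InnerProductSpace ℂ E] [CompleteSpace E]

/-- `U` is the strongly continuous one-parameter unitary group generated by `-iA`, that is,
`U t = e^{-itA}`: it is a unitary group, strongly continuous, and the pairs `(x, y)` with
`y = A x` are exactly those for which `t ↦ U t x` is differentiable at `0` with derivative `-i y`.
By Stone's theorem there is exactly one such `U` when `A` is self-adjoint. -/
structure IsUnitaryGroupOf (A : E →ₗ.[ℂ] E) (U : ℝ → E →L[ℂ] E) : Prop where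
  unitary : ∀ t, U t ∈ unitary (E →L[ℂ] E)
  zero : U 0 = 1
  add : ∀ s t, U (s + t) = U s * U t
  continuous : ∀ x, Continuous fun t => U t x
  generator : ∀ x y : E,
    (x, y) ∈ A.graph ↔ HasDerivAt (fun t : ℝ => U t x) (-(Complex.I • y)) 0

open Classical in
/-- The unitary group `e^{-itA}` of a self-adjoint operator `A`
(with the value `0` if `-iA` generates no unitary group). -/
def expNegI (A : E →ₗ.[ℂ] E) : ℝ → E →L[ℂ] E :=
  if h : ∃ U, IsUnitaryGroupOf A U then h.choose else 0

open Classical in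
/-- The vector `(A - z)⁻¹ ψ`, i.e. the `φ` in the domain of `A` with `A φ - z φ = ψ`;
for self-adjoint `A` and non-real `z` there is exactly one. -/
def resolventApply (A : E →ₗ.[ℂ] E) (z : ℂ) (ψ : E) : E :=
  if h : ∃ φ : A.domain, A φ - z • (φ : E) = ψ then (h.choose : E) else 0

/-- `m(z) = ⟨(A - z)⁻¹ ψ, ψ⟩` (the inner product of Mathlib is linear in its second slot). -/
def borelTransform (A : E →ₗ.[ℂ] E) (ψ : E) (z : ℂ) : ℂ :=
  inner ℂ ψ (resolventApply A z ψ)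

/-- `μ` is the spectral measure of `ψ` and `A`: the finite Borel measure on `ℝ` with
`⟨(A - z)⁻¹ ψ, ψ⟩ = ∫ dμ(x) / (x - z)` for all non-real `z`. For self-adjoint `A` there is exactly
one such measure. -/
structure IsSpectralMeasure (A : E →ₗ.[ℂ] E) (ψ : E) (μ : Measure ℝ) : Prop where
  finite : IsFiniteMeasure μ
  transform : ∀ z : ℂ, z.im ≠ 0 → borelTransform A ψ z = ∫ x : ℝ, ((x : ℂ) - z)⁻¹ ∂μ

open Classical in
/-- The spectral measure of the vector `ψ` and the self-adjoint operator `A`. -/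
def spectralMeasure (A : E →ₗ.[ℂ] E) (ψ : E) : Measure ℝ :=
  if h : ∃ μ, IsSpectralMeasure A ψ μ then h.choose else 0

end Abstract

/-! ## The half-line operator -/

/-- The Hilbert space `ℓ²(ℤ₊)`, `ℤ₊ = {1, 2, …}`. -/
abbrev HalfLine : Type := lp (fun _ : ℕ+ => ℂ) 2

/-- A function on `ℤ₊` extended to `n = 0` by zero (Dirichlet boundary condition). -/
def ext (u : ℕ+ → ℂ) (n : ℕ) : ℂ := if h : 0 < n then u (n.toPNat h) else 0

/-- The difference expression `a(n) u(n+1) + a(n-1) u(n-1) + b(n) u(n)`, `n ≥ 1`. -/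
def formal (a b : ℕ → ℝ) (u : ℕ+ → ℂ) (n : ℕ+) : ℂ :=
  a n * ext u (n + 1) + a (n - 1) * ext u (n - 1) + b n * ext u n

theorem ext_add (u v : ℕ+ → ℂ) (n : ℕ) : ext (u + v) n = ext u n + ext v n := by
  unfold ext; split <;> simp

theorem ext_smul (c : ℂ) (u : ℕ+ → ℂ) (n : ℕ) : ext (c • u) n = c * ext u n := by
  unfold ext; split <;> simp

theorem formal_add (a b : ℕ → ℝ) (u v : ℕ+ → ℂ) :
    formal a b (u + v) = formal a b u + formal a b v := by
  funext n; simp only [formal, ext_add, Pi.add_apply]; ring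

theorem formal_smul (a b : ℕ → ℝ) (c : ℂ) (u : ℕ+ → ℂ) :
    formal a b (c • u) = c • formal a b u := by
  funext n; simp only [formal, ext_smul, Pi.smul_apply, smul_eq_mul]; ring

theorem formal_zero (a b : ℕ → ℝ) : formal a b 0 = 0 := by
  have h := formal_smul a b 0 0
  simpa using h

/-- The half-line Jacobi operator `H₊` with Dirichlet boundary condition: it acts by the difference
expression on its maximal domain, all `u ∈ ℓ²(ℤ₊)` that the expression maps into `ℓ²(ℤ₊)`.
If `∑ 1/|a(n)| = ∞`, this is the self-adjoint closure of its restriction to finitely supported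
vectors. -/
def halfLineOp (a b : ℕ → ℝ) : HalfLine →ₗ.[ℂ] HalfLine where
  domain :=
    { carrier := {u | Memℓp (formal a b u) 2}
      add_mem' := fun {u v} hu hv => by
        have h : formal a b ⇑(u + v) = formal a b u + formal a b v := by
          rw [lp.coeFn_add, formal_add]
        change Memℓp (formal a b ⇑(u + v)) 2
        rw [h]; exact Memℓp.add hu hv
      zero_mem' := by
        change Memℓp (formal a b ⇑(0 : HalfLine)) 2
        rw [lp.coeFn_zero, formal_zero]; exact zero_memℓp
      smul_mem' := fun c u hu => by
        have h : formal a b ⇑(c • u) = c • formal a b u := by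
          rw [lp.coeFn_smul, formal_smul]
        change Memℓp (formal a b ⇑(c • u)) 2
        rw [h]; exact Memℓp.const_smul hu c }
  toFun :=
    { toFun := fun u => ⟨formal a b u.1, u.2⟩
      map_add' := fun u v => Subtype.ext (formal_add a b u.1 v.1)
      map_smul' := fun c u => Subtype.ext (formal_smul a b c u.1) }

/-- The initial vector `δ₁`. -/
def delta1 : HalfLine := lp.single 2 (1 : ℕ+) (1 : ℂ)

/-- The spectral measure `μ⁺` of `H₊` (and the vector `δ₁`). -/
def muPlus (a b : ℕ → ℝ) : Measure ℝ := spectralMeasure (halfLineOp a b) delta1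

/-- `‖φ‖_L² = ∑_{n=1}^{⌊L⌋} |φ(n)|² + (L - ⌊L⌋) |φ(⌊L⌋+1)|²`, for `L ≥ 0`. -/
def truncNormSq (L : ℝ) (φ : ℕ+ → ℂ) : ℝ :=
  ∑ n ∈ Finset.Icc 1 ⌊L⌋₊, ‖ext φ n‖ ^ 2 + (L - ⌊L⌋₊) * ‖ext φ (⌊L⌋₊ + 1)‖ ^ 2

/-- The time average `⟨A(t)⟩_T = (2/T) ∫₀^∞ e^{-2t/T} A(t) dt`. -/
def timeAvg (T : ℝ) (A : ℝ → ℝ) : ℝ :=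
  2 / T * ∫ t in Set.Ioi (0 : ℝ), Real.exp (-2 * t / T) * A t

/-! ## Generalized eigenfunctions, transfer matrices and the length scale -/

/-- The solution `u_θ(n, E)`, `n ≥ 0`, of `a(n) u(n+1) + a(n-1) u(n-1) + b(n) u(n) = E u(n)`,
`n ≥ 1`, with `u(0) = sin θ`, `u(1) = cos θ` (where `a` has no zeros). -/
def uSol (a b : ℕ → ℝ) (θ E : ℝ) : ℕ → ℝ
  | 0 => Real.sin θ
  | 1 => Real.cos θ
  | n + 2 => ((E - b (n + 1)) * uSol a b θ E (n + 1) - a n * uSol a b θ E n) / a (n + 1)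

theorem uSol_eq (a b : ℕ → ℝ) (ha : ∀ n, a n ≠ 0) (θ E : ℝ) (n : ℕ) (hn : 1 ≤ n) :
    a n * uSol a b θ E (n + 1) + a (n - 1) * uSol a b θ E (n - 1) + b n * uSol a b θ E n
      = E * uSol a b θ E n := by
  obtain ⟨k, rfl⟩ : ∃ k, n = k + 1 := ⟨n - 1, by omega⟩
  have h := ha (k + 1)
  simp only [uSol, Nat.add_sub_cancel]
  field_simp
  ring

/-- The transfer matrix `Φ(n, E)` from the site `0` to `n`. -/
def transfer (a b : ℕ → ℝ) (n : ℕ) (E : ℝ) : Matrix (Fin 2) (Fin 2) ℝ :=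
  !![uSol a b 0 E (n + 1), uSol a b (Real.pi / 2) E (n + 1);
     uSol a b 0 E n, uSol a b (Real.pi / 2) E n]

/-- The operator norm of a `2 × 2` matrix acting on the Euclidean plane. -/
def opNorm (M : Matrix (Fin 2) (Fin 2) ℝ) : ℝ := ‖Matrix.toEuclideanCLM (𝕜 := ℝ) M‖

/-- `‖Φ(E)‖_L`, where
`‖Φ(E)‖_L² = ∑_{n=1}^{⌊L⌋-1} ‖Φ(n,E)‖² + (L - ⌊L⌋) ‖Φ(⌊L⌋,E)‖²`, for `L ≥ 1`. -/
def transferNorm (a b : ℕ → ℝ) (E L : ℝ) : ℝ :=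
  √(∑ n ∈ Finset.Icc 1 (⌊L⌋₊ - 1), opNorm (transfer a b n E) ^ 2
    + (L - ⌊L⌋₊) * opNorm (transfer a b ⌊L⌋₊ E) ^ 2)

/-- The length scale `L̃⁺_ε(E)`: the `L ≥ 1` with `‖Φ(E)‖_L = 2 ‖Φ(1,E)⁻¹‖ ε⁻¹`. Exactly one `L`
satisfies this, for `ε > 0`, if `a` has no zeros and `∑ 1/|a(n)| = ∞`; so the infimum below is
that `L`. -/
def scaleTilde (a b : ℕ → ℝ) (ε E : ℝ) : ℝ :=
  sInf {L : ℝ | 1 ≤ L ∧ transferNorm a b E L = 2 * opNorm (transfer a b 1 E)⁻¹ * ε⁻¹}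

end JacobiDyn

end

/-!
Let `ε = 1/T`. By Parseval's identity for the Fourier transform,
`∫ |⟨δ_n, (H₊ - E - iε)⁻¹ δ₁⟩|² dE = 2π ∫₀^∞ e^{-2εt} |⟨δ_n, e^{-itH₊} δ₁⟩|² dt`,
so up to the factor `π T` the time average is the integral over `E` of `‖u‖_L²`, where
`u = (H₊ - z)⁻¹ δ₁`, `z = E + iε`, is extended by `u(0) = -1`.

Let `|E - x| ≤ ε` and `L̃_ε(x) ≤ L`, and suppose that `‖u‖_L² < ‖u‖² / 8`. The flux
`a(n) Im (u(n+1) ū(n))` is `-ε ‖u‖²` at `n = 0` and grows by `ε |u(n)|²` at each site `n ≥ 1`, so it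
stays below `-ε ‖u‖² / 2` up to `L`. It is also minus the determinant of the real and imaginary
parts of `Φ(n, x)⁻¹ (u(n+1), u(n))`, a vector that variation of constants keeps bounded up to the
scale `L̃_ε(x)`. Hence `|u(n)|² + |u(n+1)|²` is at least a multiple of `‖Φ(n, x)‖²`, and summation
over `n` gives a contradiction. So `‖u‖_L² ≥ ‖u‖² / 8`. Here `ε ‖u‖² = Im ⟨(H₊ - z)⁻¹ δ₁, δ₁⟩` is
the Poisson integral of `μ⁺` at `z`, and integration over `E` recovers the measure of the set of all
such `x`.
-/

noncomputable section

namespace JacobiDyn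

open MeasureTheory Filter Topology
open scoped ComplexConjugate InnerProductSpace

/-! ## Resolvents of self-adjoint operators -/

section Resolvent

variable {E : Type*} [NormedAddCommGroup E] [InnerProductSpace ℂ E] {A : E →ₗ.[ℂ] E} {w : ℂ}

theorem inner_comm_of_mem_graph (hA : A.IsFormalAdjoint A) {x y x' y' : E}
    (h : (x, y) ∈ A.graph) (h' : (x', y') ∈ A.graph) : inner ℂ y x' = inner ℂ x y' := by
  obtain ⟨u, rfl, rfl⟩ := (LinearPMap.mem_graph_iff _).1 h
  obtain ⟨v, rfl, rfl⟩ := (LinearPMap.mem_graph_iff _).1 h'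
  exact hA u v

theorem im_inner_of_mem_graph (hA : A.IsFormalAdjoint A) {φ ψ : E}
    (h : (φ, ψ + w • φ) ∈ A.graph) : (inner ℂ ψ φ).im = w.im * ‖φ‖ ^ 2 := by
  have hsymm := congrArg Complex.im (inner_comm_of_mem_graph hA h h)
  rw [inner_add_left, inner_add_right, inner_smul_left, inner_smul_right,
    ← inner_conj_symm φ ψ, inner_self_eq_norm_sq_to_K] at hsymm
  simp only [Complex.coe_algebraMap, ← Complex.ofReal_pow, Complex.add_im, Complex.im_mul_ofReal,
    Complex.conj_im] at hsymm
  linarith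

theorem abs_im_mul_norm_le (hA : A.IsFormalAdjoint A) {φ ψ : E}
    (h : (φ, ψ + w • φ) ∈ A.graph) : |w.im| * ‖φ‖ ≤ ‖ψ‖ := by
  rcases eq_or_ne φ 0 with rfl | hφ
  · simp
  refine le_of_mul_le_mul_right ?_ (norm_pos_iff.2 hφ)
  calc |w.im| * ‖φ‖ * ‖φ‖ = |(inner ℂ ψ φ).im| := by
        rw [im_inner_of_mem_graph hA h, abs_mul, abs_of_nonneg (sq_nonneg ‖φ‖)]; ring
    _ ≤ ‖ψ‖ * ‖φ‖ := (Complex.abs_im_le_norm _).trans (norm_inner_le_norm _ _)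

theorem eq_zero_of_mem_graph (hA : A.IsFormalAdjoint A) (hw : w.im ≠ 0) {φ : E}
    (h : (φ, w • φ) ∈ A.graph) : φ = 0 := by
  have hle : |w.im| * ‖φ‖ ≤ ‖(0 : E)‖ := abs_im_mul_norm_le hA (by rwa [zero_add])
  rw [norm_zero] at hle
  exact norm_le_zero_iff.1 (nonpos_of_mul_nonpos_right hle (abs_pos.2 hw))

theorem eq_of_mem_graph (hA : A.IsFormalAdjoint A) (hw : w.im ≠ 0) {φ φ' ψ : E}
    (h : (φ, ψ + w • φ) ∈ A.graph) (h' : (φ', ψ + w • φ') ∈ A.graph) : φ = φ' := by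
  refine sub_eq_zero.1 (eq_zero_of_mem_graph hA hw ?_)
  simpa only [Prod.mk_sub_mk, add_sub_add_left_eq_sub, ← smul_sub] using A.graph.sub_mem h h'

theorem resolventApply_eq (hA : A.IsFormalAdjoint A) (hw : w.im ≠ 0) {φ ψ : E}
    (h : (φ, ψ + w • φ) ∈ A.graph) : resolventApply A w ψ = φ := by
  have hex : ∃ y : A.domain, A y - w • (y : E) = ψ := by
    obtain ⟨y, hy, hAy⟩ := (LinearPMap.mem_graph_iff _).1 h
    simp only at hy hAy
    exact ⟨y, by rw [hAy, hy, add_sub_cancel_right]⟩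
  rw [resolventApply, dif_pos hex]
  refine eq_of_mem_graph hA hw ?_ h
  exact (LinearPMap.mem_graph_iff _).2 ⟨hex.choose, rfl, eq_add_of_sub_eq hex.choose_spec⟩

/-- `R` is the bounded resolvent `(A - w)⁻¹` of `A` at `w`. -/
def IsResolventAt (A : E →ₗ.[ℂ] E) (w : ℂ) (R : E →L[ℂ] E) : Prop :=
  ∀ ψ, (R ψ, ψ + w • R ψ) ∈ A.graph

namespace IsResolventAt

variable {R S : E →L[ℂ] E} {w' : ℂ}

theorem sub_eq (hA : A.IsFormalAdjoint A) (hw : w.im ≠ 0) (hR : IsResolventAt A w R)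
    (hS : IsResolventAt A w' S) : R - S = (w - w') • (R * S) := by
  ext ψ
  have hSψ : (S ψ, (ψ - (w - w') • S ψ) + w • S ψ) ∈ A.graph := by
    convert hS ψ using 2
    module
  have hSψ_eq := eq_of_mem_graph hA hw hSψ (hR (ψ - (w - w') • S ψ))
  rw [map_sub, map_smul] at hSψ_eq
  exact sub_eq_of_eq_add' (eq_sub_iff_add_eq.1 hSψ_eq).symm

theorem star_eq [CompleteSpace E] (hA : A.IsFormalAdjoint A) (hR : IsResolventAt A w R)
    (hS : IsResolventAt A (conj w) S) : star R = S := by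
  rw [ContinuousLinearMap.star_eq_adjoint, eq_comm, ContinuousLinearMap.eq_adjoint_iff]
  intro x y
  have hsymm := inner_comm_of_mem_graph hA (hS x) (hR y)
  rw [inner_add_left, inner_add_right, inner_smul_left, inner_smul_right, Complex.conj_conj]
    at hsymm
  exact (add_right_cancel hsymm).symm

end IsResolventAt

/-- The operator `A - w` as a bounded map on the graph of `A`. -/
def graphShift (A : E →ₗ.[ℂ] E) (w : ℂ) : A.graph →L[ℂ] E :=
  (ContinuousLinearMap.snd ℂ E E - w • ContinuousLinearMap.fst ℂ E E) ∘L A.graph.subtypeL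

theorem graphShift_apply (p : A.graph) : graphShift A w p = p.1.2 - w • p.1.1 := rfl

theorem mem_graph_graphShift (p : A.graph) : (p.1.1, graphShift A w p + w • p.1.1) ∈ A.graph := by
  simpa only [graphShift_apply, sub_add_cancel] using p.2

theorem norm_le_graphShift (hA : A.IsFormalAdjoint A) (hw : w.im ≠ 0) (p : A.graph) :
    ‖p‖ ≤ (|w.im|⁻¹ + (1 + ‖w‖ * |w.im|⁻¹)) * ‖graphShift A w p‖ := by
  have hfst : ‖p.1.1‖ ≤ |w.im|⁻¹ * ‖graphShift A w p‖ :=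
    (le_inv_mul_iff₀ (abs_pos.2 hw)).2 (abs_im_mul_norm_le hA (mem_graph_graphShift p))
  have hsnd : ‖p.1.2‖ ≤ ‖graphShift A w p‖ + ‖w‖ * ‖p.1.1‖ := by
    rw [← norm_smul, show p.1.2 = graphShift A w p + w • p.1.1 from (sub_add_cancel _ _).symm]
    exact norm_add_le _ _
  calc ‖p‖ ≤ ‖p.1.1‖ + ‖p.1.2‖ := max_le_add_of_nonneg (norm_nonneg _) (norm_nonneg _)
    _ ≤ ‖p.1.1‖ + (‖graphShift A w p‖ + ‖w‖ * ‖p.1.1‖) := by gcongr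
    _ ≤ |w.im|⁻¹ * ‖graphShift A w p‖
        + (‖graphShift A w p‖ + ‖w‖ * (|w.im|⁻¹ * ‖graphShift A w p‖)) := by gcongr
    _ = _ := by ring

variable [CompleteSpace E]

theorem isFormalAdjoint_self (hA : IsSelfAdjoint A) : A.IsFormalAdjoint A := by
  have hadj := LinearPMap.adjoint_isFormalAdjoint hA.dense_domain
  rwa [LinearPMap.isSelfAdjoint_def.1 hA] at hadj

theorem mem_graph_iff_forall_inner (hA : IsSelfAdjoint A) {x y : E} :
    (x, y) ∈ A.graph ↔ ∀ u v, (u, v) ∈ A.graph → inner ℂ v x = inner ℂ u y := by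
  conv_lhs =>
    rw [← LinearPMap.isSelfAdjoint_def.1 hA,
      LinearPMap.adjoint_graph_eq_graph_adjoint hA.dense_domain, Submodule.mem_adjoint_iff]
  simp only [sub_eq_zero]

theorem graphShift_surjective (hA : IsSelfAdjoint A) (hw : w.im ≠ 0) :
    Function.Surjective (graphShift A w) := by
  have hsymm := isFormalAdjoint_self hA
  have : CompleteSpace A.graph := hA.isClosed.completeSpace_coe
  have hanti : AntilipschitzWith (Real.toNNReal (|w.im|⁻¹ + (1 + ‖w‖ * |w.im|⁻¹)))
      (graphShift A w) :=
    (graphShift A w).antilipschitz_of_bound fun p => by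
      rw [Real.coe_toNNReal _ (by positivity)]
      exact norm_le_graphShift hsymm hw p
  have hclosed : IsClosed ((graphShift A w).range : Set E) :=
    hanti.isClosed_range (graphShift A w).uniformContinuous
  have : CompleteSpace (graphShift A w).range := hclosed.completeSpace_coe
  have horth : (graphShift A w).rangeᗮ = ⊥ := by
    refine (Submodule.eq_bot_iff _).2 fun v hv => ?_
    -- A vector orthogonal to the range of `A - w` is an eigenvector of `A* = A` at `conj w`.
    refine eq_zero_of_mem_graph (w := conj w) hsymm (by simpa using hw) ?_
    refine (mem_graph_iff_forall_inner hA).2 fun x y hxy => ?_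
    have hinner : inner ℂ (y - w • x) v = 0 :=
      (Submodule.mem_orthogonal _ _).1 hv _ ⟨⟨(x, y), hxy⟩, rfl⟩
    rwa [inner_sub_left, inner_smul_left, sub_eq_zero, ← inner_smul_right] at hinner
  exact LinearMap.range_eq_top.1 (Submodule.orthogonal_eq_bot_iff.1 horth)

theorem exists_mem_graph (hA : IsSelfAdjoint A) (hw : w.im ≠ 0) (ψ : E) :
    ∃ φ, (φ, ψ + w • φ) ∈ A.graph := by
  obtain ⟨p, rfl⟩ := graphShift_surjective hA hw ψ
  exact ⟨p.1.1, mem_graph_graphShift p⟩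

theorem mem_graph_resolventApply (hA : IsSelfAdjoint A) (hw : w.im ≠ 0) (ψ : E) :
    (resolventApply A w ψ, ψ + w • resolventApply A w ψ) ∈ A.graph := by
  obtain ⟨φ, hφ⟩ := exists_mem_graph hA hw ψ
  rwa [resolventApply_eq (isFormalAdjoint_self hA) hw hφ]

theorem exists_isResolventAt (hA : IsSelfAdjoint A) (hw : w.im ≠ 0) :
    ∃ R : E →L[ℂ] E, IsResolventAt A w R := by
  have hsymm := isFormalAdjoint_self hA
  have hmem := mem_graph_resolventApply hA hw
  let R : E →ₗ[ℂ] E :=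
    { toFun := resolventApply A w
      map_add' := fun x y => eq_of_mem_graph hsymm hw (hmem (x + y)) <| by
        convert A.graph.add_mem (hmem x) (hmem y) using 1
        rw [Prod.mk_add_mk, smul_add, add_add_add_comm]
      map_smul' := fun c x => eq_of_mem_graph hsymm hw (hmem (c • x)) <| by
        convert A.graph.smul_mem c (hmem x) using 1
        rw [Prod.smul_mk, smul_add, smul_comm, RingHom.id_apply] }
  exact ⟨R.mkContinuous |w.im|⁻¹ fun x =>
    (le_inv_mul_iff₀ (abs_pos.2 hw)).2 (abs_im_mul_norm_le hsymm (hmem x)), hmem⟩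

namespace IsResolventAt

variable {R : E →L[ℂ] E}

theorem denseRange (hA : IsSelfAdjoint A) (hw : w.im ≠ 0) (hR : IsResolventAt A w R) :
    DenseRange R := by
  refine hA.dense_domain.mono fun x hx => ⟨A ⟨x, hx⟩ - w • x, ?_⟩
  refine eq_of_mem_graph (isFormalAdjoint_self hA) hw (hR _) ?_
  exact (LinearPMap.mem_graph_iff _).2 ⟨⟨x, hx⟩, rfl, (sub_add_cancel _ _).symm⟩

theorem sub_star_eq (hA : IsSelfAdjoint A) (hw : w.im ≠ 0) (hR : IsResolventAt A w R) :
    R - star R = (w - conj w) • (star R * R) := by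
  have hsymm := isFormalAdjoint_self hA
  have hw' : (conj w).im ≠ 0 := by simpa using hw
  obtain ⟨S, hS⟩ := exists_isResolventAt hA hw'
  rw [hR.star_eq hsymm hS, ← neg_sub, hS.sub_eq hsymm hw' hR, ← neg_smul, neg_sub]

theorem isStarNormal (hA : IsSelfAdjoint A) (hw : w.im ≠ 0) (hR : IsResolventAt A w R) :
    IsStarNormal R := by
  have hsymm := isFormalAdjoint_self hA
  have hw' : (conj w).im ≠ 0 := by simpa using hw
  obtain ⟨S, hS⟩ := exists_isResolventAt hA hw'
  have hsub : w - conj w ≠ 0 := by simpa [Complex.sub_conj] using hw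
  refine ⟨smul_right_injective _ hsub ?_⟩
  change (w - conj w) • (star R * R) = (w - conj w) • (R * star R)
  rw [← hR.sub_star_eq hA hw, hR.star_eq hsymm hS, hR.sub_eq hsymm hw hS]

end IsResolventAt

end Resolvent

/-! ## Stone's theorem -/

section Symbols

theorem norm_exp_I_mul_sub_one_sub_le (y : ℝ) :
    ‖Complex.exp (Complex.I * y) - 1 - Complex.I * y‖ ≤ 2 * |y| := by
  calc _ ≤ ‖Complex.exp (Complex.I * y) - 1‖ + ‖Complex.I * (y : ℂ)‖ := norm_sub_le _ _
    _ ≤ |y| + |y| := add_le_add Real.norm_exp_I_mul_ofReal_sub_one_le (by simp)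
    _ = 2 * |y| := (two_mul _).symm

theorem norm_exp_I_mul_sub_one_sub_le_sq (y : ℝ) :
    ‖Complex.exp (Complex.I * y) - 1 - Complex.I * y‖ ≤ 2 * y ^ 2 := by
  have hnorm : ‖Complex.I * (y : ℂ)‖ = |y| := by simp
  rw [← sq_abs]
  rcases le_total |y| 1 with hy | hy
  · have hsq := Complex.norm_exp_sub_one_sub_id_le (x := Complex.I * y) (hnorm.trans_le hy)
    rw [hnorm] at hsq
    nlinarith [sq_nonneg |y|]
  · nlinarith [norm_exp_I_mul_sub_one_sub_le y]

/-- The circle `{(x - i)⁻¹ : x ∈ ℝ} ∪ {0}`, which contains the spectrum of the resolvent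
`(A - i)⁻¹` of a self-adjoint operator. -/
def OnCircle (r : ℂ) : Prop := ‖r‖ ^ 2 = r.im

theorem OnCircle.inv_eq {r : ℂ} (hr : OnCircle r) (hr₀ : r ≠ 0) :
    r⁻¹ = ((r⁻¹).re : ℂ) - Complex.I := by
  have hnormSq : Complex.normSq r = r.im := (Complex.normSq_eq_norm_sq r).trans hr
  have him : r.im ≠ 0 := hnormSq ▸ (Complex.normSq_pos.2 hr₀).ne'
  apply Complex.ext
  · simp
  · rw [Complex.inv_im, hnormSq, neg_div, div_self him]
    simp

/-- `e^{-itx} (x - i)⁻¹` as a function of `r = (x - i)⁻¹`. The factor `(x - i)⁻¹` makes it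
continuous at the point `r = 0` that corresponds to `x = ∞`. -/
def phase (t : ℝ) (r : ℂ) : ℂ := Complex.exp (Complex.I * (-(t * (r⁻¹).re) : ℝ)) * r

theorem norm_phase (t : ℝ) (r : ℂ) : ‖phase t r‖ = ‖r‖ := by
  rw [phase, norm_mul, Complex.norm_exp_I_mul_ofReal, one_mul]

theorem phase_zero (r : ℂ) : phase 0 r = r := by simp [phase]

theorem phase_add (s t : ℝ) (r : ℂ) :
    phase (s + t) r = Complex.exp (Complex.I * (-(s * (r⁻¹).re) : ℝ)) * phase t r := by
  rw [phase, phase, ← mul_assoc, ← Complex.exp_add]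
  congr 2
  push_cast
  ring

theorem phase_mul_phase (s t : ℝ) (r : ℂ) : phase s r * phase t r = phase (s + t) r * r := by
  rw [phase_add, phase]
  ring

theorem continuous_phase (t : ℝ) : Continuous (phase t) := by
  rw [continuous_iff_continuousAt]
  intro r
  rcases eq_or_ne r 0 with rfl | hr
  · rw [ContinuousAt, show phase t 0 = 0 by simp [phase], tendsto_zero_iff_norm_tendsto_zero]
    simpa only [norm_phase] using tendsto_norm_zero
  · have hinv : ContinuousAt (fun r : ℂ => (-(t * (r⁻¹).re) : ℝ)) r :=
      (continuousAt_const.mul (Complex.continuous_re.continuousAt.comp (continuousAt_inv₀ hr))).neg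
    have hexponent := Complex.continuous_ofReal.continuousAt.comp hinv
    exact ((continuousAt_const.mul hexponent).cexp).mul continuousAt_id

theorem abs_re_inv_mul_norm_le_one (r : ℂ) : |(r⁻¹).re| * ‖r‖ ≤ 1 :=
  calc |(r⁻¹).re| * ‖r‖ ≤ ‖r‖⁻¹ * ‖r‖ := by
        gcongr
        exact (Complex.abs_re_le_norm _).trans_eq (norm_inv r)
    _ ≤ 1 := inv_mul_le_one

theorem norm_phase_sub_phase_le (s t : ℝ) (r : ℂ) : ‖phase t r - phase s r‖ ≤ |t - s| := by
  have hfactor : phase t r - phase s r = Complex.exp (Complex.I * (-(s * (r⁻¹).re) : ℝ))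
      * ((Complex.exp (Complex.I * (-((t - s) * (r⁻¹).re) : ℝ)) - 1) * r) := by
    rw [← add_sub_cancel s t, phase_add, phase, phase, add_sub_cancel_left]
    ring
  rw [hfactor, norm_mul, Complex.norm_exp_I_mul_ofReal, one_mul, norm_mul]
  calc _ ≤ |-((t - s) * (r⁻¹).re)| * ‖r‖ := by
        gcongr
        exact Real.norm_exp_I_mul_ofReal_sub_one_le
    _ = |t - s| * (|(r⁻¹).re| * ‖r‖) := by rw [abs_neg, abs_mul, mul_assoc]
    _ ≤ |t - s| * 1 := by gcongr; exact abs_re_inv_mul_norm_le_one r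
    _ = |t - s| := mul_one _

/-- `(e^{-itx} - 1 + itx) (x - i)⁻¹`, the error of the first order expansion of `phase` at `t = 0`,
as a function of `r = (x - i)⁻¹`; here `x (x - i)⁻¹ = 1 + i r`. -/
def phaseRemainder (t : ℝ) (r : ℂ) : ℂ := phase t r - r + (t * Complex.I) * (1 + Complex.I * r)

theorem continuous_phaseRemainder (t : ℝ) : Continuous (phaseRemainder t) := by
  have := continuous_phase t
  unfold phaseRemainder
  fun_prop

theorem phaseRemainder_zero_right (t : ℝ) : phaseRemainder t 0 = t * Complex.I := by
  simp [phaseRemainder, phase]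

theorem phaseRemainder_eq {r : ℂ} (hr : OnCircle r) (hr₀ : r ≠ 0) (t : ℝ) :
    phaseRemainder t r
      = (Complex.exp (Complex.I * (-(t * (r⁻¹).re) : ℝ)) - 1
          - Complex.I * (-(t * (r⁻¹).re) : ℝ)) * r := by
  have hre : ((r⁻¹).re : ℂ) * r = 1 + Complex.I * r := by
    have hinv : r⁻¹ * r = 1 := inv_mul_cancel₀ hr₀
    rw [hr.inv_eq hr₀] at hinv
    linear_combination hinv
  rw [phaseRemainder, ← hre, phase]
  push_cast
  ring

theorem norm_phaseRemainder_le {r : ℂ} (hr : OnCircle r) (t : ℝ) :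
    ‖phaseRemainder t r‖ ≤ 2 * |t| := by
  rcases eq_or_ne r 0 with rfl | hr₀
  · rw [phaseRemainder_zero_right, norm_mul, Complex.norm_real, Complex.norm_I, Real.norm_eq_abs]
    linarith [abs_nonneg t]
  · rw [phaseRemainder_eq hr hr₀, norm_mul]
    calc _ ≤ (2 * |-(t * (r⁻¹).re)|) * ‖r‖ := by
          gcongr
          exact norm_exp_I_mul_sub_one_sub_le _
      _ = (2 * |t|) * (|(r⁻¹).re| * ‖r‖) := by rw [abs_neg, abs_mul]; ring
      _ ≤ (2 * |t|) * 1 := by gcongr; exact abs_re_inv_mul_norm_le_one r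
      _ = 2 * |t| := mul_one _

theorem norm_phaseRemainder_mul_le {r : ℂ} (hr : OnCircle r) (t : ℝ) :
    ‖phaseRemainder t r * r‖ ≤ 2 * t ^ 2 := by
  rcases eq_or_ne r 0 with rfl | hr₀
  · rw [mul_zero, norm_zero]
    positivity
  · rw [phaseRemainder_eq hr hr₀, norm_mul, norm_mul]
    calc _ ≤ (2 * (-(t * (r⁻¹).re)) ^ 2) * ‖r‖ * ‖r‖ := by
          gcongr
          exact norm_exp_I_mul_sub_one_sub_le_sq _
      _ = (2 * t ^ 2) * (|(r⁻¹).re| * ‖r‖) ^ 2 := by rw [mul_pow, sq_abs]; ring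
      _ ≤ (2 * t ^ 2) * 1 := by
          gcongr
          exact pow_le_one₀ (by positivity) (abs_re_inv_mul_norm_le_one r)
      _ = 2 * t ^ 2 := mul_one _

end Symbols

section Stone

variable {E : Type*} [NormedAddCommGroup E] [InnerProductSpace ℂ E]

theorem clm_ext_of_denseRange {R V W : E →L[ℂ] E} (hR : DenseRange R)
    (hVW : ∀ x, V (R x) = W (R x)) : V = W :=
  DFunLike.coe_injective (hR.equalizer V.continuous W.continuous (funext hVW))

theorem continuous_apply_of_denseRange {R : E →L[ℂ] E} (hR : DenseRange R) {V : ℝ → E →L[ℂ] E}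
    (hV : ∀ t x, ‖V t x‖ ≤ ‖x‖) (hVR : ∀ y, Continuous fun t => V t (R y)) (x : E) :
    Continuous fun t => V t x := by
  refine continuous_of_uniform_approx_of_continuous fun u hu => ?_
  obtain ⟨ε, hε, hεu⟩ := Metric.mem_uniformity_dist.1 hu
  obtain ⟨y, hy⟩ := hR.exists_dist_lt x hε
  refine ⟨_, hVR y, fun t => hεu ?_⟩
  rw [dist_eq_norm, ← map_sub]
  exact (hV t _).trans_lt (by rwa [← dist_eq_norm])

theorem isLittleO_apply_of_denseRange {R : E →L[ℂ] E} (hR : DenseRange R) {B : ℝ → E →L[ℂ] E}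
    {C : ℝ} (hB : ∀ t, ‖B t‖ ≤ C * |t|) (hBR : ∀ t, ‖B t * R‖ ≤ C * t ^ 2) (x : E) :
    (fun t => B t x) =o[𝓝 0] fun t : ℝ => t := by
  have hC : 0 ≤ C := by simpa using (norm_nonneg _).trans (hB 1)
  rw [Asymptotics.isLittleO_iff]
  intro c hc
  obtain ⟨y, hy⟩ := hR.exists_dist_lt x (show 0 < c / 2 / (C + 1) by positivity)
  rw [dist_eq_norm, lt_div_iff₀ (by positivity)] at hy
  have hsmall : ∀ᶠ t : ℝ in 𝓝 0, C * |t| * ‖y‖ < c / 2 := by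
    have hcont : Continuous fun t : ℝ => C * |t| * ‖y‖ := by fun_prop
    exact hcont.continuousAt.eventually_lt_const (by simpa using hc)
  filter_upwards [hsmall] with t ht
  have hfar : ‖B t (x - R y)‖ ≤ c / 2 * |t| :=
    calc ‖B t (x - R y)‖ ≤ C * |t| * ‖x - R y‖ := (B t).le_of_opNorm_le (hB t) _
      _ ≤ (C + 1) * |t| * ‖x - R y‖ := by gcongr; linarith
      _ = ‖x - R y‖ * (C + 1) * |t| := by ring
      _ ≤ c / 2 * |t| := by gcongr
  have hnear : ‖(B t * R) y‖ ≤ c / 2 * |t| :=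
    calc ‖(B t * R) y‖ ≤ C * t ^ 2 * ‖y‖ := (B t * R).le_of_opNorm_le (hBR t) _
      _ = C * |t| * ‖y‖ * |t| := by rw [← sq_abs]; ring
      _ ≤ c / 2 * |t| := by gcongr
  calc ‖B t x‖ = ‖B t (x - R y) + (B t * R) y‖ := by
        rw [map_sub, mul_apply_eq_comp, sub_add_cancel]
    _ ≤ c / 2 * |t| + c / 2 * |t| := norm_add_le_of_le hfar hnear
    _ = c * ‖t‖ := by rw [Real.norm_eq_abs]; ring

variable [CompleteSpace E] {R : E →L[ℂ] E}

/-- For `R = (A - i)⁻¹` this is the operator `e^{-itA} (A - i)⁻¹`. -/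
def phaseOp (R : E →L[ℂ] E) (t : ℝ) : E →L[ℂ] E := cfc (phase t) R

/-- For `R = (A - i)⁻¹` this is the operator `(e^{-itA} - 1 + itA) (A - i)⁻¹`. -/
def phaseRemainderOp (R : E →L[ℂ] E) (t : ℝ) : E →L[ℂ] E := cfc (phaseRemainder t) R

theorem norm_phaseOp_sub_le (s t : ℝ) : ‖phaseOp R t - phaseOp R s‖ ≤ |t - s| := by
  rw [phaseOp, phaseOp, ← cfc_sub (phase t) (phase s) R (continuous_phase t).continuousOn
    (continuous_phase s).continuousOn]
  exact norm_cfc_le (abs_nonneg _) fun r _ => norm_phase_sub_phase_le s t r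

section Normal

variable [IsStarNormal R]

theorem phaseOp_zero : phaseOp R 0 = R := by
  rw [phaseOp, show phase 0 = fun r => r from funext phase_zero, cfc_id' ℂ R]

theorem phaseOp_mul_phaseOp (s t : ℝ) : phaseOp R s * phaseOp R t = phaseOp R (s + t) * R := by
  have hs := (continuous_phase s).continuousOn (s := spectrum ℂ R)
  have ht := (continuous_phase t).continuousOn (s := spectrum ℂ R)
  have hst := (continuous_phase (s + t)).continuousOn (s := spectrum ℂ R)
  calc phaseOp R s * phaseOp R t = cfc (fun r => phase (s + t) r * r) R := by
        simp only [phaseOp, ← cfc_mul (phase s) (phase t) R hs ht, phase_mul_phase]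
    _ = phaseOp R (s + t) * R := by
        rw [cfc_mul (phase (s + t)) (fun r => r) R hst, cfc_id' ℂ R, phaseOp]

theorem commute_phaseOp (t : ℝ) : Commute (phaseOp R t) R := by
  have hcommute := cfc_commute_cfc (phase t) (fun r => r) R
  rwa [cfc_id' ℂ R] at hcommute

theorem star_phaseOp_mul_phaseOp (t : ℝ) : star (phaseOp R t) * phaseOp R t = star R * R := by
  have ht := continuous_phase t
  calc star (phaseOp R t) * phaseOp R t = cfc (fun r => star (phase t r) * phase t r) R := by
        rw [phaseOp, ← cfc_star, ← cfc_mul (fun r => star (phase t r)) (phase t) R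
          ht.star.continuousOn ht.continuousOn]
    _ = cfc (fun r : ℂ => star r * r) R := by
        simp only [RCLike.star_def, Complex.conj_mul', norm_phase]
    _ = star R * R := by
        rw [cfc_mul (fun r : ℂ => star r) (fun r => r) R, cfc_id' ℂ R, cfc_star_id R]

theorem norm_phaseOp_apply (t : ℝ) (x : E) : ‖phaseOp R t x‖ = ‖R x‖ := by
  have hsq (B : E →L[ℂ] E) : RCLike.re (inner ℂ ((star B * B) x) x) = ‖B x‖ ^ 2 := by
    rw [mul_apply_eq_comp, ContinuousLinearMap.star_eq_adjoint,
      ContinuousLinearMap.adjoint_inner_left, inner_self_eq_norm_sq]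
  rw [← sq_eq_sq₀ (norm_nonneg _) (norm_nonneg _), ← hsq, ← hsq, star_phaseOp_mul_phaseOp]

theorem phaseRemainderOp_eq (t : ℝ) :
    phaseRemainderOp R t = phaseOp R t - R + (t * Complex.I) • (1 + Complex.I • R) := by
  have ht := continuous_phase t
  simp only [phaseRemainderOp, funext (phaseRemainder.eq_1 t)]
  rw [cfc_add (a := R) (fun r => phase t r - r)
    (fun r => (t * Complex.I) * (1 + Complex.I * r)) (by fun_prop) (by fun_prop),
    cfc_sub (phase t) (fun r => r) R ht.continuousOn, cfc_id' ℂ R,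
    cfc_const_mul (t * Complex.I) (fun r => 1 + Complex.I * r) R,
    cfc_const_add 1 (fun r => Complex.I * r) R, cfc_const_mul Complex.I (fun r => r) R,
    cfc_id' ℂ R, phaseOp, map_one]

end Normal

theorem norm_phaseRemainderOp_le (hcircle : ∀ r ∈ spectrum ℂ R, OnCircle r) (t : ℝ) :
    ‖phaseRemainderOp R t‖ ≤ 2 * |t| :=
  norm_cfc_le (by positivity) fun r hr => norm_phaseRemainder_le (hcircle r hr) t

theorem norm_phaseRemainderOp_mul_le [IsStarNormal R] (hcircle : ∀ r ∈ spectrum ℂ R, OnCircle r)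
    (t : ℝ) : ‖phaseRemainderOp R t * R‖ ≤ 2 * t ^ 2 := by
  have hcfc : phaseRemainderOp R t * R = cfc (fun r => phaseRemainder t r * r) R := by
    rw [cfc_mul (phaseRemainder t) (fun r => r) R (continuous_phaseRemainder t).continuousOn,
      cfc_id' ℂ R, phaseRemainderOp]
  rw [hcfc]
  exact norm_cfc_le (by positivity) fun r hr => norm_phaseRemainder_mul_le (hcircle r hr) t

/-- For `R = (A - i)⁻¹` this is the unitary group `e^{-itA}`: the bounded extension of
`R x ↦ e^{-itA} R x` from the dense range of `R`. -/
def stoneGroup (R : E →L[ℂ] E) (t : ℝ) : E →L[ℂ] E :=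
  (phaseOp R t).toLinearMap.extendOfNorm R.toLinearMap

section Group

variable [IsStarNormal R] (hR : DenseRange R)
include hR

theorem stoneGroup_apply (t : ℝ) (x : E) : stoneGroup R t (R x) = phaseOp R t x :=
  LinearMap.extendOfNorm_eq (f := (phaseOp R t).toLinearMap) (e := R.toLinearMap) hR
    ⟨1, fun x => (norm_phaseOp_apply t x).le.trans_eq (one_mul _).symm⟩ x

theorem norm_stoneGroup_apply_le (t : ℝ) (x : E) : ‖stoneGroup R t x‖ ≤ ‖x‖ := by
  have hle := LinearMap.norm_extendOfNorm_apply_le (f := (phaseOp R t).toLinearMap)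
    (e := R.toLinearMap) hR 1 (fun x => (norm_phaseOp_apply t x).le.trans_eq (one_mul _).symm) x
  rwa [one_mul] at hle

theorem stoneGroup_zero : stoneGroup R 0 = 1 :=
  clm_ext_of_denseRange hR fun x => by
    rw [stoneGroup_apply hR, phaseOp_zero, one_apply_eq_self]

theorem stoneGroup_add (s t : ℝ) : stoneGroup R (s + t) = stoneGroup R s * stoneGroup R t := by
  have hphase : phaseOp R (s + t) = stoneGroup R s * phaseOp R t :=
    clm_ext_of_denseRange hR fun y =>
      calc phaseOp R (s + t) (R y) = phaseOp R s (phaseOp R t y) :=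
            DFunLike.congr_fun (phaseOp_mul_phaseOp s t).symm y
        _ = stoneGroup R s (R (phaseOp R t y)) := (stoneGroup_apply hR s _).symm
        _ = stoneGroup R s (phaseOp R t (R y)) :=
            congrArg _ (DFunLike.congr_fun (commute_phaseOp t).eq y).symm
  refine clm_ext_of_denseRange hR fun x => ?_
  rw [mul_apply_eq_comp, stoneGroup_apply hR, stoneGroup_apply hR, hphase, mul_apply_eq_comp]

theorem stoneGroup_mem_unitary (t : ℝ) : stoneGroup R t ∈ unitary (E →L[ℂ] E) := by
  have hinv (t : ℝ) : stoneGroup R (-t) * stoneGroup R t = 1 := by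
    rw [← stoneGroup_add hR, neg_add_cancel, stoneGroup_zero hR]
  have hinv' : stoneGroup R t * stoneGroup R (-t) = 1 := by simpa only [neg_neg] using hinv (-t)
  have hnorm (x : E) : ‖stoneGroup R t x‖ = ‖x‖ := by
    refine le_antisymm (norm_stoneGroup_apply_le hR t x) ?_
    calc ‖x‖ = ‖stoneGroup R (-t) (stoneGroup R t x)‖ := by
          rw [← mul_apply_eq_comp, hinv, one_apply_eq_self]
      _ ≤ ‖stoneGroup R t x‖ := norm_stoneGroup_apply_le hR _ _
  have hstar : star (stoneGroup R t) * stoneGroup R t = 1 :=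
    (ContinuousLinearMap.norm_map_iff_adjoint_comp_self _).1 hnorm
  exact Unitary.mem_iff.2 ⟨hstar, by rwa [left_inv_eq_right_inv hstar hinv']⟩

theorem continuous_stoneGroup (x : E) : Continuous fun t => stoneGroup R t x := by
  refine continuous_apply_of_denseRange hR (norm_stoneGroup_apply_le hR) (fun y => ?_) x
  have hlip : LipschitzWith ‖y‖₊ fun t => stoneGroup R t (R y) := by
    refine LipschitzWith.of_dist_le_mul fun t s => ?_
    rw [stoneGroup_apply hR, stoneGroup_apply hR, dist_eq_norm, Real.dist_eq, ← sub_apply, mul_comm]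
    exact (phaseOp R t - phaseOp R s).le_of_opNorm_le (norm_phaseOp_sub_le s t) y
  exact hlip.continuous

theorem hasDerivAt_stoneGroup (hcircle : ∀ r ∈ spectrum ℂ R, OnCircle r) (x : E) :
    HasDerivAt (fun t => stoneGroup R t (R x)) (-(Complex.I • (x + Complex.I • R x))) 0 := by
  have hremainder (t : ℝ) : stoneGroup R t (R x) - stoneGroup R 0 (R x)
      - (t - 0) • (-(Complex.I • (x + Complex.I • R x))) = phaseRemainderOp R t x := by
    rw [phaseRemainderOp_eq, stoneGroup_apply hR, stoneGroup_apply hR, phaseOp_zero, sub_zero,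
      smul_neg, sub_neg_eq_add]
    simp only [add_apply, sub_apply, smul_apply, one_apply_eq_self, mul_smul, Complex.coe_smul]
  rw [hasDerivAt_iff_isLittleO]
  simp only [hremainder]
  simp only [sub_zero]
  exact isLittleO_apply_of_denseRange hR (norm_phaseRemainderOp_le hcircle)
    (norm_phaseRemainderOp_mul_le hcircle) x

end Group

theorem inner_map_map_of_mem_unitary {V : E →L[ℂ] E} (hV : V ∈ unitary (E →L[ℂ] E)) (x y : E) :
    inner ℂ (V x) (V y) = inner ℂ x y := by
  rw [← ContinuousLinearMap.adjoint_inner_left, ← ContinuousLinearMap.star_eq_adjoint,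
    ← mul_apply_eq_comp, (Unitary.mem_iff.1 hV).1, one_apply_eq_self]

theorem norm_map_of_mem_unitary {V : E →L[ℂ] E} (hV : V ∈ unitary (E →L[ℂ] E)) (x : E) :
    ‖V x‖ = ‖x‖ := by
  rw [@norm_eq_sqrt_re_inner ℂ, inner_map_map_of_mem_unitary hV, ← @norm_eq_sqrt_re_inner ℂ]

theorem inner_comm_of_hasDerivAt_unitary {U : ℝ → E →L[ℂ] E}
    (hU : ∀ t, U t ∈ unitary (E →L[ℂ] E)) (hU₀ : U 0 = 1) {x y x' y' : E}
    (h : HasDerivAt (fun t => U t x) (-(Complex.I • y)) 0)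
    (h' : HasDerivAt (fun t => U t x') (-(Complex.I • y')) 0) : inner ℂ y x' = inner ℂ x y' := by
  have hderiv := h.inner ℂ h'
  simp only [fun t => inner_map_map_of_mem_unitary (hU t) x x', hU₀] at hderiv
  have hzero := hderiv.unique (hasDerivAt_const (0 : ℝ) (inner ℂ x x'))
  simp only [one_apply_eq_self, inner_neg_right, inner_neg_left, inner_smul_left,
    inner_smul_right, Complex.conj_I] at hzero
  exact mul_left_cancel₀ Complex.I_ne_zero (by linear_combination hzero)

variable {A : E →ₗ.[ℂ] E}

namespace IsResolventAt

theorem onCircle (hA : IsSelfAdjoint A) (hR : IsResolventAt A Complex.I R) {r : ℂ}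
    (hr : r ∈ spectrum ℂ R) : OnCircle r := by
  have := hR.isStarNormal hA (by simp)
  have hcfc : cfc (fun r : ℂ => r - star r) R
      = cfc (fun r : ℂ => (Complex.I - conj Complex.I) • (star r * r)) R := by
    rw [cfc_sub (fun r : ℂ => r) (fun r => star r) R, cfc_id' ℂ R, cfc_star_id R,
      cfc_smul (Complex.I - conj Complex.I) (fun r : ℂ => star r * r) R,
      cfc_mul (fun r : ℂ => star r) (fun r => r) R, cfc_id' ℂ R, cfc_star_id R]
    exact hR.sub_star_eq hA (by simp)
  have hr_eq : r - conj r = (Complex.I - conj Complex.I) * (conj r * r) :=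
    (cfc_eq_cfc_iff_eqOn ‹_› (by fun_prop) (by fun_prop)).1 hcfc hr
  rw [Complex.sub_conj, Complex.conj_I, Complex.conj_mul'] at hr_eq
  have hI : (2 * Complex.I) * (‖r‖ ^ 2 : ℝ) = (2 * Complex.I) * (r.im : ℝ) := by
    push_cast at hr_eq ⊢
    linear_combination -hr_eq
  exact Complex.ofReal_injective (mul_left_cancel₀ (by simp) hI)

theorem hasDerivAt_stoneGroup (hA : IsSelfAdjoint A) (hR : IsResolventAt A Complex.I R) {x y : E}
    (hxy : (x, y) ∈ A.graph) : HasDerivAt (fun t => stoneGroup R t x) (-(Complex.I • y)) 0 := by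
  have := hR.isStarNormal hA (by simp)
  have hx : x = R (y - Complex.I • x) :=
    eq_of_mem_graph (isFormalAdjoint_self hA) (w := Complex.I) (by simp)
      (by rwa [sub_add_cancel]) (hR (y - Complex.I • x))
  simpa only [← hx, sub_add_cancel] using JacobiDyn.hasDerivAt_stoneGroup
    (hR.denseRange hA (by simp)) (fun _ => hR.onCircle hA) (y - Complex.I • x)

theorem isUnitaryGroupOf_stoneGroup (hA : IsSelfAdjoint A) (hR : IsResolventAt A Complex.I R) :
    IsUnitaryGroupOf A (stoneGroup R) := by
  have := hR.isStarNormal hA (by simp)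
  have hdense := hR.denseRange hA (by simp)
  have hunitary := stoneGroup_mem_unitary hdense
  have hzero := stoneGroup_zero hdense
  exact ⟨hunitary, hzero, stoneGroup_add hdense, continuous_stoneGroup hdense, fun x y =>
    ⟨hR.hasDerivAt_stoneGroup hA, fun hderiv => (mem_graph_iff_forall_inner hA).2 fun u v huv =>
      inner_comm_of_hasDerivAt_unitary hunitary hzero (hR.hasDerivAt_stoneGroup hA huv) hderiv⟩⟩

end IsResolventAt

theorem isUnitaryGroupOf_expNegI (hA : IsSelfAdjoint A) : IsUnitaryGroupOf A (expNegI A) := by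
  obtain ⟨R, hR⟩ := exists_isResolventAt hA (w := Complex.I) (by simp)
  have hexists : ∃ U, IsUnitaryGroupOf A U := ⟨_, hR.isUnitaryGroupOf_stoneGroup hA⟩
  rw [expNegI, dif_pos hexists]
  exact hexists.choose_spec

end Stone

/-! ## Spectral measures -/

section Riesz

open scoped ComplexOrder

variable {X : Type*} [TopologicalSpace X] {Λ : C(X, ℂ) →ₗ[ℂ] ℂ}

theorem map_realToRCLike_nonneg (hΛ : ∀ f, 0 ≤ Λ (star f * f)) {f : C(X, ℝ)} (hf : 0 ≤ f) :
    0 ≤ Λ (f.realToRCLike ℂ) := by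
  let g : C(X, ℂ) := ContinuousMap.realToRCLike ℂ ⟨fun x => √(f x), f.continuous.sqrt⟩
  have hg : f.realToRCLike ℂ = star g * g := by
    ext x
    change (f x : ℂ) = conj (√(f x) : ℂ) * (√(f x) : ℂ)
    rw [Complex.conj_ofReal, ← Complex.ofReal_mul, Real.mul_self_sqrt (show 0 ≤ f x from hf x)]
  exact hg ▸ hΛ g

theorem im_map_realToRCLike (hΛ : ∀ f, 0 ≤ Λ (star f * f)) (f : C(X, ℝ)) :
    (Λ (f.realToRCLike ℂ)).im = 0 := by
  have hparts : f.realToRCLike ℂ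
      = (f ⊔ 0).realToRCLike ℂ - (-f ⊔ 0).realToRCLike ℂ := by
    ext x
    change (f x : ℂ) = ((max (f x) 0 : ℝ) : ℂ) - ((max (-f x) 0 : ℝ) : ℂ)
    rw [← Complex.ofReal_sub, max_zero_sub_max_neg_zero_eq_self]
  have hpart {g : C(X, ℝ)} (hg : 0 ≤ g) : (Λ (g.realToRCLike ℂ)).im = 0 :=
    (Complex.nonneg_iff.1 (map_realToRCLike_nonneg hΛ hg)).2.symm
  rw [hparts, map_sub, Complex.sub_im, hpart le_sup_right, hpart le_sup_right, sub_zero]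

theorem exists_measure_of_nonneg [CompactSpace X] [T2Space X] [MeasurableSpace X] [BorelSpace X]
    (hΛ : ∀ f, 0 ≤ Λ (star f * f)) :
    ∃ ν : Measure X, IsFiniteMeasure ν ∧ ∀ f : C(X, ℂ), Λ f = ∫ x, f x ∂ν := by
  let Λre : C(X, ℝ) →ₗ[ℝ] ℝ :=
    Complex.reLm ∘ₗ Λ.restrictScalars ℝ ∘ₗ (Complex.ofRealCLM.compLeftContinuous ℝ X).toLinearMap
  let Λc : CompactlySupportedContinuousMap X ℝ →ₚ[ℝ] ℝ := PositiveLinearMap.mk₀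
    { toFun := fun f => Λre f.toContinuousMap
      map_add' := fun f g => map_add Λre f.toContinuousMap g.toContinuousMap
      map_smul' := fun c f => map_smul Λre c f.toContinuousMap }
    fun f hf => (Complex.nonneg_iff.1 (map_realToRCLike_nonneg hΛ (f := f.toContinuousMap) hf)).1
  have hreal (g : C(X, ℝ)) :
      Λ (g.realToRCLike ℂ) = ∫ x, (g x : ℂ) ∂(RealRMK.rieszMeasure Λc) := by
    apply Complex.ext
    · rw [integral_complex_ofReal]
      exact (RealRMK.integral_rieszMeasure Λc
        (CompactlySupportedContinuousMap.continuousMapEquiv g)).symm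
    · rw [integral_complex_ofReal, im_map_realToRCLike hΛ, Complex.ofReal_im]
  refine ⟨RealRMK.rieszMeasure Λc, inferInstance, fun f => ?_⟩
  let u : C(X, ℝ) := ⟨fun x => (f x).re, Complex.continuous_re.comp f.continuous⟩
  let v : C(X, ℝ) := ⟨fun x => (f x).im, Complex.continuous_im.comp f.continuous⟩
  have hf : f = u.realToRCLike ℂ + Complex.I • v.realToRCLike ℂ := by
    ext x
    change f x = ((f x).re : ℂ) + Complex.I * ((f x).im : ℂ)
    rw [mul_comm, Complex.re_add_im]
  have hintegrable (g : C(X, ℝ)) : Integrable (fun x => (g x : ℂ)) (RealRMK.rieszMeasure Λc) :=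
    (g.realToRCLike ℂ).continuous.integrable_of_hasCompactSupport (.of_compactSpace _)
  calc Λ f = Λ (u.realToRCLike ℂ) + Complex.I * Λ (v.realToRCLike ℂ) := by
        conv_lhs => rw [hf, map_add, map_smul, smul_eq_mul]
    _ = ∫ x, (u x : ℂ) + Complex.I * (v x : ℂ) ∂(RealRMK.rieszMeasure Λc) := by
        rw [integral_add (hintegrable u) ((hintegrable v).const_mul _), integral_const_mul, hreal,
          hreal]
    _ = ∫ x, f x ∂(RealRMK.rieszMeasure Λc) :=
        integral_congr_ae (ae_of_all _ fun x => (DFunLike.congr_fun hf x).symm)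

end Riesz

section Symbol

/-- `(x - z)⁻¹` as a function of `r = (x - i)⁻¹`. -/
def resolventSymbol (z r : ℂ) : ℂ := r * (1 + (Complex.I - z) * r)⁻¹

variable {z r : ℂ}

theorem one_add_mul_ne_zero (hr : OnCircle r) (hz : z.im ≠ 0) : 1 + (Complex.I - z) * r ≠ 0 := by
  intro hzero
  have hr₀ : r ≠ 0 := by rintro rfl; simp at hzero
  have hinv : r⁻¹ = z - Complex.I := inv_eq_of_mul_eq_one_right (by linear_combination -hzero)
  have him : -1 = z.im - 1 := by
    simpa using congrArg Complex.im ((hr.inv_eq hr₀).symm.trans hinv)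
  exact hz (by linarith)

theorem continuousOn_resolventSymbol (hz : z.im ≠ 0) :
    ContinuousOn (resolventSymbol z) {r | OnCircle r} :=
  continuousOn_id.mul (ContinuousOn.inv₀ (by fun_prop) fun _ hr => one_add_mul_ne_zero hr hz)

theorem resolventSymbol_eq_add (hr : OnCircle r) (hz : z.im ≠ 0) :
    resolventSymbol z r = r + (z - Complex.I) * (r * resolventSymbol z r) := by
  have hinv := mul_inv_cancel₀ (one_add_mul_ne_zero hr hz)
  rw [resolventSymbol]
  linear_combination r * hinv

theorem resolventSymbol_eq_inv (hr : OnCircle r) (hr₀ : r ≠ 0) :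
    resolventSymbol z r = (((r⁻¹).re : ℂ) - z)⁻¹ := by
  have hre : ((r⁻¹).re : ℂ) - z = (1 + (Complex.I - z) * r) * r⁻¹ := by
    rw [add_mul, mul_inv_cancel_right₀ hr₀, one_mul]
    linear_combination -hr.inv_eq hr₀
  rw [hre, mul_inv, inv_inv, mul_comm, resolventSymbol]

end Symbol

section SpectralMeasure

variable {E : Type*} [NormedAddCommGroup E] [InnerProductSpace ℂ E] [CompleteSpace E]
  {A : E →ₗ.[ℂ] E} {R : E →L[ℂ] E}

open scoped ComplexOrder in
theorem exists_measure_inner_cfcHom (hR : IsStarNormal R) (ψ : E) :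
    ∃ ν : Measure (spectrum ℂ R), IsFiniteMeasure ν ∧
      ∀ f : C(spectrum ℂ R, ℂ), inner ℂ ψ (cfcHom hR f ψ) = ∫ r, f r ∂ν := by
  have : CompactSpace (spectrum ℂ R) := isCompact_iff_compactSpace.1 (spectrum.isCompact R)
  refine exists_measure_of_nonneg (Λ := (innerSL ℂ ψ).toLinearMap ∘ₗ
    (ContinuousLinearMap.apply ℂ E ψ).toLinearMap ∘ₗ (cfcHom hR).toAlgHom.toLinearMap) fun f => ?_
  change 0 ≤ inner ℂ ψ (cfcHom hR (star f * f) ψ)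
  rw [map_mul, map_star, mul_apply_eq_comp, ContinuousLinearMap.star_eq_adjoint,
    ContinuousLinearMap.adjoint_inner_right]
  exact Complex.nonneg_iff.2 ⟨inner_self_nonneg (𝕜 := ℂ), (inner_self_im (𝕜 := ℂ) _).symm⟩

namespace IsResolventAt

theorem resolventApply_eq_cfc (hA : IsSelfAdjoint A) (hR : IsResolventAt A Complex.I R) {z : ℂ}
    (hz : z.im ≠ 0) (ψ : E) : resolventApply A z ψ = cfc (resolventSymbol z) R ψ := by
  have := hR.isStarNormal hA (by simp)
  have hcont : ContinuousOn (resolventSymbol z) (spectrum ℂ R) :=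
    (continuousOn_resolventSymbol hz).mono fun _ => hR.onCircle hA
  have hcfc : cfc (resolventSymbol z) R = R + (z - Complex.I) • (R * cfc (resolventSymbol z) R) :=
    calc cfc (resolventSymbol z) R
        = cfc (fun r => r + (z - Complex.I) * (r * resolventSymbol z r)) R :=
          cfc_congr fun r hr => resolventSymbol_eq_add (hR.onCircle hA hr) hz
      _ = R + (z - Complex.I) • (R * cfc (resolventSymbol z) R) := by
          rw [cfc_add (a := R) (fun r => r) _ (by fun_prop) (by fun_prop), cfc_id' ℂ R,
            cfc_const_mul (z - Complex.I) _ R (by fun_prop),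
            cfc_mul (fun r => r) (resolventSymbol z) R (by fun_prop) hcont, cfc_id' ℂ R]
  set φ := cfc (resolventSymbol z) R ψ
  have hφ : φ = R (ψ + (z - Complex.I) • φ) := by
    rw [map_add, map_smul]
    exact DFunLike.congr_fun hcfc ψ
  have hmem := hR (ψ + (z - Complex.I) • φ)
  rw [← hφ, sub_smul, add_assoc, sub_add_cancel] at hmem
  exact resolventApply_eq (isFormalAdjoint_self hA) hz hmem

/-- The spectral measure is the image under `r ↦ r⁻¹ + i` of the measure that the continuous
functional calculus of `R = (A - i)⁻¹` gives on the circle, without the point `r = 0`. -/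
theorem exists_isSpectralMeasure (hA : IsSelfAdjoint A) (hR : IsResolventAt A Complex.I R) (ψ : E) :
    ∃ μ, IsSpectralMeasure A ψ μ := by
  have hnormal := hR.isStarNormal hA (by simp)
  obtain ⟨ν, _, hν⟩ := exists_measure_inner_cfcHom hnormal ψ
  let position : spectrum ℂ R → ℝ := fun r => ((r : ℂ)⁻¹).re
  let S : Set (spectrum ℂ R) := {r | (r : ℂ) ≠ 0}
  have hposition : Measurable position :=
    Complex.measurable_re.comp (measurable_inv.comp measurable_subtype_coe)
  have hS : MeasurableSet S := measurable_subtype_coe (measurableSet_singleton (0 : ℂ)).compl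
  refine ⟨(ν.restrict S).map position, inferInstance, fun z hz => ?_⟩
  have hcont : ContinuousOn (resolventSymbol z) (spectrum ℂ R) :=
    (continuousOn_resolventSymbol hz).mono fun _ => hR.onCircle hA
  have hmeas : Measurable fun x : ℝ => ((x : ℂ) - z)⁻¹ := by fun_prop
  calc borelTransform A ψ z = ∫ r : spectrum ℂ R, resolventSymbol z r ∂ν := by
        rw [borelTransform, hR.resolventApply_eq_cfc hA hz, cfc_apply _ R hnormal hcont, hν]
        rfl
    _ = ∫ r in S, resolventSymbol z r ∂ν := by
        refine (setIntegral_eq_integral_of_forall_compl_eq_zero fun r hr => ?_).symm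
        rw [not_not.1 hr, resolventSymbol, zero_mul]
    _ = ∫ r in S, ((position r : ℂ) - z)⁻¹ ∂ν :=
        setIntegral_congr_fun hS fun r hr => resolventSymbol_eq_inv (hR.onCircle hA r.2) hr
    _ = ∫ x : ℝ, ((x : ℂ) - z)⁻¹ ∂(ν.restrict S).map position :=
        (integral_map hposition.aemeasurable hmeas.aestronglyMeasurable).symm

end IsResolventAt

theorem isSpectralMeasure_spectralMeasure (hA : IsSelfAdjoint A) (ψ : E) :
    IsSpectralMeasure A ψ (spectralMeasure A ψ) := by
  obtain ⟨R, hR⟩ := exists_isResolventAt hA (w := Complex.I) (by simp)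
  have hexists := hR.exists_isSpectralMeasure hA ψ
  rw [spectralMeasure, dif_pos hexists]
  exact hexists.choose_spec

end SpectralMeasure

/-! ## Parseval's identity for the resolvent -/

section Plancherel

open scoped FourierTransform ContDiff

variable {V F : Type*} [NormedAddCommGroup V] [InnerProductSpace ℝ V] [FiniteDimensional ℝ V]
  [MeasurableSpace V] [BorelSpace V] [NormedAddCommGroup F] [InnerProductSpace ℂ F]

theorem continuous_fourier {f : V → F} (hf : Integrable f) : Continuous (𝓕 f) :=
  VectorFourier.fourierIntegral_continuous Real.continuous_fourierChar continuous_inner hf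

theorem norm_sq_eq_integral_norm_sq {α : Type*} [MeasurableSpace α] {μ : Measure α} (f : Lp F 2 μ) :
    ‖f‖ ^ 2 = ∫ x, ‖f x‖ ^ 2 ∂μ := by
  rw [← inner_self_eq_norm_sq (𝕜 := ℂ), L2.inner_def, ← integral_re (L2.integrable_inner f f)]
  simp only [inner_self_eq_norm_sq]

variable [CompleteSpace F] {f : V → F}

/-- Both sides have the same integral against every test function. -/
theorem fourier_toLp_ae_eq (hf : Integrable f) (hf₂ : MemLp f 2) :
    (𝓕 (hf₂.toLp f) : Lp F 2 (volume : Measure V)) =ᵐ[volume] 𝓕 f := by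
  refine ae_eq_of_integral_contDiff_smul_eq ((Lp.memLp _).locallyIntegrable (by norm_num))
    (continuous_fourier hf).locallyIntegrable fun g hg hg_supp => ?_
  have hg' : ContDiff ℝ ∞ (Complex.ofRealCLM ∘ g) := by fun_prop
  let φ : SchwartzMap V ℂ := (hg_supp.comp_left rfl : HasCompactSupport (Complex.ofRealCLM ∘ g))
    |>.toSchwartzMap hg'
  have hself := VectorFourier.integral_fourierIntegral_smul_eq_flip (L := innerₗ V)
    (μ := (volume : Measure V)) (ν := (volume : Measure V))
    Real.continuous_fourierChar continuous_inner φ.integrable hf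
  rw [flip_innerₗ] at hself
  calc ∫ x, g x • (𝓕 (hf₂.toLp f) : Lp F 2 (volume : Measure V)) x
      = Lp.toTemperedDistribution (𝓕 (hf₂.toLp f) : Lp F 2 (volume : Measure V)) φ := by
        rw [Lp.toTemperedDistribution_apply]
        exact integral_congr_ae (ae_of_all _ fun x => (Complex.coe_smul _ _).symm)
    _ = Lp.toTemperedDistribution (hf₂.toLp f : Lp F 2 (volume : Measure V)) (𝓕 φ) := by
        rw [← Lp.fourier_toTemperedDistribution_eq, TemperedDistribution.fourier_apply]
    _ = ∫ x, (𝓕 φ) x • f x := by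
        rw [Lp.toTemperedDistribution_apply]
        exact integral_congr_ae (hf₂.coeFn_toLp.mono fun x hx => congrArg _ hx)
    _ = ∫ x, φ x • 𝓕 f x := hself
    _ = ∫ x, g x • 𝓕 f x := integral_congr_ae (ae_of_all _ fun x => Complex.coe_smul _ _)

theorem memLp_fourier (hf : Integrable f) (hf₂ : MemLp f 2) : MemLp (𝓕 f) 2 :=
  (memLp_congr_ae (fourier_toLp_ae_eq hf hf₂)).1 (Lp.memLp _)

theorem integral_norm_sq_fourier (hf : Integrable f) (hf₂ : MemLp f 2) :
    ∫ x, ‖𝓕 f x‖ ^ 2 = ∫ x, ‖f x‖ ^ 2 := by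
  have hfourier := norm_sq_eq_integral_norm_sq (𝓕 (hf₂.toLp f) : Lp F 2 (volume : Measure V))
  have htoLp := norm_sq_eq_integral_norm_sq (hf₂.toLp f)
  rw [Lp.norm_fourier_eq, htoLp] at hfourier
  calc ∫ x, ‖𝓕 f x‖ ^ 2
      = ∫ x, ‖(𝓕 (hf₂.toLp f) : Lp F 2 (volume : Measure V)) x‖ ^ 2 :=
        integral_congr_ae ((fourier_toLp_ae_eq hf hf₂).mono fun x hx => by simp only [hx])
    _ = ∫ x, ‖hf₂.toLp f x‖ ^ 2 := hfourier.symm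
    _ = ∫ x, ‖f x‖ ^ 2 := integral_congr_ae (hf₂.coeFn_toLp.mono fun x hx => by simp only [hx])

end Plancherel

section Laplace

variable {E : Type*} [NormedAddCommGroup E] [InnerProductSpace ℂ E]

/-- The matrix element `⟨η, U t ψ⟩`, switched on at `t = 0` and damped at the rate `ε`. -/
def dampedElement (U : ℝ → E →L[ℂ] E) (ε : ℝ) (η ψ : E) : ℝ → ℂ :=
  (Set.Ioi 0).indicator fun t => Complex.exp (-(ε * t : ℝ)) * inner ℂ η (U t ψ)

theorem norm_sq_dampedElement (ε : ℝ) (η ψ : E) :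
    (fun t => ‖dampedElement U ε η ψ t‖ ^ 2)
      = (Set.Ioi 0).indicator fun t => Real.exp (-(2 * ε * t)) * ‖inner ℂ η (U t ψ)‖ ^ 2 := by
  funext t
  by_cases ht : t ∈ Set.Ioi (0 : ℝ)
  · rw [dampedElement, Set.indicator_of_mem ht, Set.indicator_of_mem ht, norm_mul, mul_pow,
      ← Complex.ofReal_neg, Complex.norm_exp_ofReal, ← Real.exp_nat_mul]
    push_cast
    ring_nf
  · rw [dampedElement, Set.indicator_of_notMem ht, Set.indicator_of_notMem ht, norm_zero,
      zero_pow two_ne_zero]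

namespace IsUnitaryGroupOf

variable [CompleteSpace E] {A : E →ₗ.[ℂ] E} {U : ℝ → E →L[ℂ] E} (hU : IsUnitaryGroupOf A U)
include hU

theorem norm_inner_le (t : ℝ) (η ψ : E) : ‖inner ℂ η (U t ψ)‖ ≤ ‖η‖ * ‖ψ‖ :=
  (norm_inner_le_norm _ _).trans_eq (by rw [norm_map_of_mem_unitary (hU.unitary t)])

theorem continuous_inner (η ψ : E) : Continuous fun t => inner ℂ η (U t ψ) :=
  continuous_const.inner (hU.continuous ψ)

theorem hasDerivAt_inner {x y : E} (hxy : (x, y) ∈ A.graph) (η : E) (t : ℝ) :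
    HasDerivAt (fun s => inner ℂ η (U s x)) (-(Complex.I * inner ℂ η (U t y))) t := by
  have hgroup : (fun s => U s x) = fun s => U t (U (s - t) x) := by
    funext s
    rw [← mul_apply_eq_comp, ← hU.add, add_sub_cancel]
  have hzero : HasDerivAt (fun s => U s x) (-(Complex.I • y)) (t - t) := by
    rw [sub_self]
    exact (hU.generator x y).1 hxy
  have hderiv : HasDerivAt (fun s => U s x) (U t (-(Complex.I • y))) t := by
    rw [hgroup]
    exact ((U t).restrictScalars ℝ).hasFDerivAt.comp_hasDerivAt t (hzero.comp_sub_const t t)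
  refine ((hasDerivAt_const t η).inner ℂ hderiv).congr_deriv ?_
  rw [map_neg, map_smul, inner_neg_right, inner_smul_right, inner_zero_left, add_zero]

theorem integrableOn_laplace {z : ℂ} (hz : 0 < z.im) (η ψ : E) :
    IntegrableOn (fun t : ℝ => Complex.exp (Complex.I * z * t) * inner ℂ η (U t ψ))
      (Set.Ioi 0) := by
  have hcont := hU.continuous_inner η ψ
  refine Integrable.mono' ((exp_neg_integrableOn_Ioi 0 hz).mul_const (‖η‖ * ‖ψ‖))
    (by fun_prop) (ae_of_all _ fun t => ?_)
  rw [norm_mul, Complex.norm_exp, show (Complex.I * z * t).re = -z.im * t by simp]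
  gcongr
  exact hU.norm_inner_le t η ψ

theorem tendsto_laplace_zero {z : ℂ} (hz : 0 < z.im) (η ψ : E) :
    Tendsto (fun t : ℝ => Complex.exp (Complex.I * z * t) * inner ℂ η (U t ψ)) atTop (𝓝 0) := by
  have hexp : Tendsto (fun t : ℝ => Real.exp (-z.im * t)) atTop (𝓝 0) :=
    Real.tendsto_exp_atBot.comp (tendsto_id.const_mul_atTop_of_neg (neg_neg_of_pos hz))
  refine squeeze_zero_norm (fun t => ?_) (by simpa using hexp.mul_const (‖η‖ * ‖ψ‖))
  rw [norm_mul, Complex.norm_exp, show (Complex.I * z * t).re = -(z.im * t) by simp]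
  gcongr
  exact hU.norm_inner_le t η ψ

theorem inner_resolventApply (hA : IsSelfAdjoint A) {z : ℂ} (hz : 0 < z.im) (η ψ : E) :
    inner ℂ η (resolventApply A z ψ) = Complex.I *
      ∫ t in Set.Ioi (0 : ℝ), Complex.exp (Complex.I * z * t) * inner ℂ η (U t ψ) := by
  set φ := resolventApply A z ψ
  have hφ : (φ, ψ + z • φ) ∈ A.graph := mem_graph_resolventApply hA hz.ne' ψ
  have hderiv (t : ℝ) :
      HasDerivAt (fun t : ℝ => Complex.exp (Complex.I * z * t) * inner ℂ η (U t φ))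
        (-Complex.I * (Complex.exp (Complex.I * z * t) * inner ℂ η (U t ψ))) t := by
    have hexp := ((Complex.ofRealCLM.hasDerivAt (x := t)).const_mul (Complex.I * z)).cexp
    refine (hexp.mul (hU.hasDerivAt_inner hφ η t)).congr_deriv ?_
    rw [map_add, map_smul, inner_add_right, inner_smul_right, Complex.ofRealCLM_apply,
      Complex.ofRealCLM_apply, Complex.ofReal_one]
    ring
  have hFTC := integral_Ioi_of_hasDerivAt_of_tendsto (a := 0)
    (hderiv 0).continuousAt.continuousWithinAt (fun t _ => hderiv t)
    ((hU.integrableOn_laplace hz η ψ).const_mul (-Complex.I)) (hU.tendsto_laplace_zero hz η φ)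
  simp only [integral_const_mul, Complex.ofReal_zero, mul_zero, Complex.exp_zero, one_mul, hU.zero,
    one_apply_eq_self, zero_sub] at hFTC
  linear_combination hFTC

theorem integrable_dampedElement {ε : ℝ} (hε : 0 < ε) (η ψ : E) :
    Integrable (dampedElement U ε η ψ) := by
  refine (integrable_indicator_iff measurableSet_Ioi).2 ?_
  refine (hU.integrableOn_laplace (z := ε * Complex.I) (by simpa using hε) η ψ).congr_fun
    (fun t _ => ?_) measurableSet_Ioi
  have hexponent : Complex.I * (ε * Complex.I) * t = -((ε * t : ℝ) : ℂ) := by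
    push_cast
    linear_combination (ε * t : ℂ) * Complex.I_sq
  simp only [hexponent]

theorem integrableOn_exp_mul_norm_sq {ε : ℝ} (hε : 0 < ε) (η ψ : E) :
    IntegrableOn (fun t => Real.exp (-(2 * ε * t)) * ‖inner ℂ η (U t ψ)‖ ^ 2) (Set.Ioi 0) := by
  have hcont := hU.continuous_inner η ψ
  have hexp := (exp_neg_integrableOn_Ioi 0 (mul_pos two_pos hε)).mul_const ((‖η‖ * ‖ψ‖) ^ 2)
  refine Integrable.mono' hexp (by fun_prop) (ae_of_all _ fun t => ?_)
  rw [Real.norm_of_nonneg (by positivity), neg_mul]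
  gcongr
  exact hU.norm_inner_le t η ψ

theorem memLp_dampedElement {ε : ℝ} (hε : 0 < ε) (η ψ : E) :
    MemLp (dampedElement U ε η ψ) 2 := by
  rw [memLp_two_iff_integrable_sq_norm (hU.integrable_dampedElement hε η ψ).1,
    norm_sq_dampedElement]
  exact (integrable_indicator_iff measurableSet_Ioi).2 (hU.integrableOn_exp_mul_norm_sq hε η ψ)

open scoped FourierTransform

theorem inner_resolventApply_eq_fourier (hA : IsSelfAdjoint A) {ε : ℝ} (hε : 0 < ε) (η ψ : E)
    (x : ℝ) : inner ℂ η (resolventApply A (x + ε * Complex.I) ψ)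
      = Complex.I * 𝓕 (dampedElement U ε η ψ) (x * (-(2 * Real.pi))⁻¹) := by
  rw [hU.inner_resolventApply hA (by simpa using hε), Real.fourier_real_eq_integral_exp_smul,
    ← integral_indicator measurableSet_Ioi]
  congr 2 with t
  by_cases ht : t ∈ Set.Ioi (0 : ℝ)
  · rw [dampedElement, Set.indicator_of_mem ht, Set.indicator_of_mem ht, smul_eq_mul, ← mul_assoc,
      ← Complex.exp_add]
    congr 2
    have hpi : (Real.pi : ℂ) ≠ 0 := Complex.ofReal_ne_zero.2 Real.pi_ne_zero
    push_cast
    field_simp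
    linear_combination (ε * t : ℂ) * Complex.I_sq
  · rw [dampedElement, Set.indicator_of_notMem ht, Set.indicator_of_notMem ht, smul_zero]

theorem integrable_norm_sq_inner_resolventApply (hA : IsSelfAdjoint A) {ε : ℝ} (hε : 0 < ε)
    (η ψ : E) :
    Integrable fun x : ℝ => ‖inner ℂ η (resolventApply A (x + ε * Complex.I) ψ)‖ ^ 2 := by
  have hf := hU.integrable_dampedElement hε η ψ
  have hfourier := memLp_fourier hf (hU.memLp_dampedElement hε η ψ)
  have hsq := (memLp_two_iff_integrable_sq_norm hfourier.1).1 hfourier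
  simp only [hU.inner_resolventApply_eq_fourier hA hε, norm_mul, Complex.norm_I, one_mul]
  exact hsq.comp_mul_right' (by simp [Real.pi_ne_zero])

theorem integral_norm_sq_inner_resolventApply (hA : IsSelfAdjoint A) {ε : ℝ} (hε : 0 < ε)
    (η ψ : E) :
    ∫ x : ℝ, ‖inner ℂ η (resolventApply A (x + ε * Complex.I) ψ)‖ ^ 2 = 2 * Real.pi *
      ∫ t in Set.Ioi (0 : ℝ), Real.exp (-(2 * ε * t)) * ‖inner ℂ η (U t ψ)‖ ^ 2 := by
  have hf := hU.integrable_dampedElement hε η ψ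
  simp only [hU.inner_resolventApply_eq_fourier hA hε, norm_mul, Complex.norm_I, one_mul]
  rw [Measure.integral_comp_mul_right (fun x => ‖𝓕 (dampedElement U ε η ψ) x‖ ^ 2), inv_inv,
    abs_neg, abs_of_pos Real.two_pi_pos, smul_eq_mul,
    integral_norm_sq_fourier hf (hU.memLp_dampedElement hε η ψ), norm_sq_dampedElement,
    integral_indicator measurableSet_Ioi]

end IsUnitaryGroupOf

end Laplace

/-! ## Self-adjointness of the half-line operator -/

section HalfLine

variable {a b : ℕ → ℝ}

theorem ext_coe (u : ℕ+ → ℂ) (n : ℕ+) : ext u n = u n := by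
  rw [ext, dif_pos n.pos]
  rfl

theorem ext_succ (u : ℕ+ → ℂ) (k : ℕ) : ext u (k + 1) = u k.succPNat :=
  ext_coe u k.succPNat

theorem ext_zero (u : ℕ+ → ℂ) : ext u 0 = 0 :=
  dif_neg (lt_irrefl 0)

theorem mem_graph_halfLineOp {u v : HalfLine} :
    (u, v) ∈ (halfLineOp a b).graph ↔ ∀ n : ℕ+, ext v n = formal a b u n := by
  rw [LinearPMap.mem_graph_iff]
  constructor
  · rintro ⟨x, hxu, hxv⟩ n
    dsimp only at hxu hxv
    rw [← hxv, ← hxu, ext_coe]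
    rfl
  · intro hv
    have heq : ⇑v = formal a b u := funext fun n => (ext_coe v n).symm.trans (hv n)
    have hmem : Memℓp (formal a b u) 2 := heq ▸ lp.memℓp v
    exact ⟨⟨u, hmem⟩, rfl, Subtype.ext heq.symm⟩

theorem hasSum_norm_sq_ext_succ (u : HalfLine) :
    HasSum (fun k => ‖ext u (k + 1)‖ ^ 2) (‖u‖ ^ 2) := by
  have hsum : HasSum (fun n : ℕ+ => ‖u n‖ ^ 2) (‖u‖ ^ 2) := by
    simpa using lp.hasSum_norm (p := 2) (by norm_num) u
  simpa only [ext_succ] using! (Equiv.pnatEquivNat.symm.hasSum_iff).2 hsum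

theorem summable_norm_sq_ext (u : HalfLine) : Summable fun n => ‖ext u n‖ ^ 2 :=
  (summable_nat_add_iff 1).1 (hasSum_norm_sq_ext_succ u).summable

theorem hasSum_inner_ext_succ (u v : HalfLine) :
    HasSum (fun k => conj (ext u (k + 1)) * ext v (k + 1)) (inner ℂ u v) := by
  simpa only [ext_succ, RCLike.inner_apply, mul_comm] using!
    (Equiv.pnatEquivNat.symm.hasSum_iff).2 (lp.hasSum_inner (𝕜 := ℂ) u v)

/-- The Wronskian `a(n) (conj u(n+1) v(n) - conj u(n) v(n+1))`, the boundary term in Green's formula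
for the difference expression. -/
def boundaryTerm (a : ℕ → ℝ) (u v : ℕ → ℂ) (n : ℕ) : ℂ :=
  a n * (conj (u (n + 1)) * v n - conj (u n) * v (n + 1))

theorem sum_formal_sub_eq_boundaryTerm (u v : ℕ+ → ℂ) (N : ℕ) :
    (∑ k ∈ Finset.range N, conj (formal a b u k.succPNat) * ext v (k + 1))
      - (∑ k ∈ Finset.range N, conj (ext u (k + 1)) * formal a b v k.succPNat)
      = boundaryTerm a (ext u) (ext v) N := by
  induction N with
  | zero => simp [boundaryTerm, ext_zero]
  | succ N ih =>
    rw [Finset.sum_range_succ, Finset.sum_range_succ, add_sub_add_comm, ih]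
    simp only [boundaryTerm, formal, Nat.succPNat_coe, Nat.succ_eq_add_one, Nat.add_sub_cancel,
      map_add, map_mul, Complex.conj_ofReal]
    ring

theorem norm_boundaryTerm_le (a : ℕ → ℝ) (u v : ℕ → ℂ) (n : ℕ) :
    ‖boundaryTerm a u v n‖ ≤
      |a n| * ((‖u (n + 1)‖ ^ 2 + ‖u n‖ ^ 2) + (‖v (n + 1)‖ ^ 2 + ‖v n‖ ^ 2)) := by
  rw [boundaryTerm, norm_mul, Complex.norm_real, Real.norm_eq_abs]
  refine mul_le_mul_of_nonneg_left ((norm_sub_le _ _).trans ?_) (abs_nonneg _)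
  rw [norm_mul, norm_mul, RCLike.norm_conj, RCLike.norm_conj]
  nlinarith [sq_nonneg (‖u (n + 1)‖ - ‖v n‖), sq_nonneg (‖u n‖ - ‖v (n + 1)‖),
    sq_nonneg (‖u (n + 1)‖), sq_nonneg (‖u n‖), sq_nonneg (‖v (n + 1)‖), sq_nonneg (‖v n‖)]

theorem eq_zero_of_tendsto_of_norm_le_mul {E : Type*} [NormedAddCommGroup E] {a s : ℕ → ℝ}
    (ha : ¬ Summable fun n => |a (n + 1)|⁻¹) (hs : Summable s) {f : ℕ → E} {ℓ : E}
    (hf : Tendsto f atTop (𝓝 ℓ)) (hle : ∀ n, ‖f n‖ ≤ |a n| * s n) : ℓ = 0 := by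
  by_contra hℓ
  have hpos : 0 < ‖ℓ‖ / 2 := half_pos (norm_pos_iff.2 hℓ)
  have hlarge : ∀ᶠ n in atTop, ‖ℓ‖ / 2 < ‖f n‖ :=
    hf.norm.eventually (lt_mem_nhds (half_lt_self (norm_pos_iff.2 hℓ)))
  refine ha ((summable_nat_add_iff 1 (f := fun n => |a n|⁻¹)).2 ?_)
  refine Summable.of_norm_bounded_eventually_nat (hs.mul_left (‖ℓ‖ / 2)⁻¹) ?_
  filter_upwards [hlarge] with n hn
  have hprod : ‖ℓ‖ / 2 < |a n| * s n := hn.trans_le (hle n)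
  have ha_pos : 0 < |a n| := (abs_nonneg _).lt_of_ne' fun hzero => by
    rw [hzero, zero_mul] at hprod
    exact hprod.not_gt hpos
  rw [norm_inv, norm_abs_eq_norm, Real.norm_eq_abs, inv_mul_eq_div, le_div_iff₀ hpos,
    inv_mul_le_iff₀ ha_pos]
  exact hprod.le

theorem isFormalAdjoint_halfLineOp (ha : ¬ Summable fun n : ℕ => |a (n + 1)|⁻¹) :
    (halfLineOp a b).IsFormalAdjoint (halfLineOp a b) := by
  intro x y
  have hlim : Tendsto (boundaryTerm a (ext x) (ext y)) atTop
      (𝓝 (inner ℂ (halfLineOp a b x) (y : HalfLine) - inner ℂ (x : HalfLine)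
        (halfLineOp a b y))) := by
    refine ((hasSum_inner_ext_succ _ _).tendsto_sum_nat.sub
      (hasSum_inner_ext_succ _ _).tendsto_sum_nat).congr fun N => ?_
    rw [← sum_formal_sub_eq_boundaryTerm (b := b)]
    simp only [ext_succ]
    rfl
  have hsummable (u : HalfLine) : Summable fun n => ‖ext u (n + 1)‖ ^ 2 + ‖ext u n‖ ^ 2 :=
    (hasSum_norm_sq_ext_succ u).summable.add (summable_norm_sq_ext u)
  exact sub_eq_zero.1 (eq_zero_of_tendsto_of_norm_le_mul ha ((hsummable x).add (hsummable y)) hlim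
    (norm_boundaryTerm_le a _ _))

/-- The basis vector `δ_n`, with `δ_0 = 0`. -/
def site (n : ℕ) : HalfLine := if h : 0 < n then lp.single 2 (n.toPNat h) (1 : ℂ) else 0

theorem inner_site (n : ℕ) (u : HalfLine) : inner ℂ (site n) u = ext u n := by
  unfold site ext
  split
  · simp [lp.inner_single_left]
  · exact inner_zero_left u

theorem inner_delta1 (u : HalfLine) : inner ℂ delta1 u = ext u 1 :=
  inner_site 1 u

theorem ext_site (m k : ℕ) : ext (site m) k = if k = m ∧ 0 < m then 1 else 0 := by
  unfold site ext
  by_cases hk : 0 < k <;> by_cases hm : 0 < m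
  · rw [dif_pos hk, dif_pos hm, lp.coeFn_single, Pi.single_apply]
    simp only [hm, and_true, ← PNat.coe_inj]
    rfl
  · simp [hk, hm]
  · rw [dif_neg hk, if_neg (by lia)]
  · simp [hk, hm]

theorem site_mem_graph (n : ℕ+) : (site n, (a n : ℂ) • site (n + 1)
    + (a (n - 1) : ℂ) • site (n - 1) + (b n : ℂ) • site n) ∈ (halfLineOp a b).graph := by
  rw [mem_graph_halfLineOp]
  intro k
  rw [lp.coeFn_add, ext_add, lp.coeFn_add, ext_add, lp.coeFn_smul, ext_smul,
    lp.coeFn_smul, ext_smul, lp.coeFn_smul, ext_smul, formal]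
  simp only [ext_site]
  have hk := k.pos
  have hn := n.pos
  generalize (k : ℕ) = k at *
  generalize (n : ℕ) = n at *
  grind

theorem dense_domain_halfLineOp : Dense ((halfLineOp a b).domain : Set HalfLine) := by
  rw [Submodule.dense_iff_topologicalClosure_eq_top, Submodule.topologicalClosure_eq_top_iff,
    Submodule.eq_bot_iff]
  intro u hu
  have hzero (n : ℕ+) : ext u n = 0 := by
    rw [← inner_site]
    exact (Submodule.mem_orthogonal _ _).1 hu _
      (LinearPMap.mem_domain_of_mem_graph (site_mem_graph n))
  exact lp.ext (funext fun n => (ext_coe u n).symm.trans (hzero n))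

theorem isSelfAdjoint_halfLineOp (ha : ¬ Summable fun n : ℕ => |a (n + 1)|⁻¹) :
    IsSelfAdjoint (halfLineOp a b) := by
  rw [LinearPMap.isSelfAdjoint_def]
  refine le_antisymm (LinearPMap.le_of_le_graph ?_)
    ((isFormalAdjoint_halfLineOp ha).le_adjoint dense_domain_halfLineOp)
  rintro ⟨x, y⟩ hxy
  rw [LinearPMap.adjoint_graph_eq_graph_adjoint dense_domain_halfLineOp,
    Submodule.mem_adjoint_iff] at hxy
  refine mem_graph_halfLineOp.2 fun n => ?_
  have htest := hxy _ _ (site_mem_graph n)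
  simp only [inner_add_left, inner_smul_left, inner_site, Complex.conj_ofReal] at htest
  rw [formal]
  linear_combination -htest

end HalfLine

/-! ## Interpolated partial sums -/

section InterpSum

open Finset

/-- The partial sum `f 1 + ⋯ + f x`, interpolated linearly to real `x ≥ 0`; both `truncNormSq` and
the square of `transferNorm` are of this form. -/
def interpSum (f : ℕ → ℝ) (x : ℝ) : ℝ :=
  ∑ n ∈ Icc 1 ⌊x⌋₊, f n + (x - ⌊x⌋₊) * f (⌊x⌋₊ + 1)

variable {f g : ℕ → ℝ} {x y : ℝ}

theorem interpSum_add (f g : ℕ → ℝ) (x : ℝ) :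
    interpSum (fun n => f n + g n) x = interpSum f x + interpSum g x := by
  simp only [interpSum, sum_add_distrib]
  ring

theorem interpSum_const_mul (c : ℝ) (f : ℕ → ℝ) (x : ℝ) :
    interpSum (fun n => c * f n) x = c * interpSum f x := by
  simp only [interpSum, ← mul_sum]
  ring

theorem interpSum_add_one (f : ℕ → ℝ) (hx : 0 ≤ x) :
    interpSum f (x + 1) = f 1 + interpSum (fun n => f (n + 1)) x := by
  have hsum : ∑ n ∈ Icc 1 (⌊x⌋₊ + 1), f n = f 1 + ∑ n ∈ Icc 1 ⌊x⌋₊, f (n + 1) := by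
    rw [← Ico_add_one_right_eq_Icc, ← Ico_add_one_right_eq_Icc, sum_Ico_add' f,
      sum_eq_sum_Ico_succ_bot (by lia)]
  rw [interpSum, interpSum, Nat.floor_add_one hx, hsum]
  push_cast
  ring

theorem interpSum_le_interpSum (hx : 0 ≤ x) (hfg : ∀ n ∈ Icc 1 (⌊x⌋₊ + 1), f n ≤ g n) :
    interpSum f x ≤ interpSum g x := by
  have hfrac : 0 ≤ x - ⌊x⌋₊ := sub_nonneg.2 (Nat.floor_le hx)
  refine add_le_add (sum_le_sum fun n hn => hfg n ?_)
    (mul_le_mul_of_nonneg_left (hfg _ ?_) hfrac) <;>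
  grind

theorem sum_Icc_le_interpSum (hf : ∀ n, 0 ≤ f n) (hx : 0 ≤ x) {n : ℕ} (hn : n ≤ ⌊x⌋₊) :
    ∑ k ∈ Icc 1 n, f k ≤ interpSum f x := by
  refine (sum_le_sum_of_subset_of_nonneg (Icc_subset_Icc_right hn) fun k _ _ => hf k).trans ?_
  exact le_add_of_nonneg_right (mul_nonneg (sub_nonneg.2 (Nat.floor_le hx)) (hf _))

theorem interpSum_add_mul_le (hf : ∀ n, 0 ≤ f n) (hx : 0 ≤ x) (hxy : x ≤ y) :
    interpSum f x + (min y (⌊x⌋₊ + 1) - x) * f (⌊x⌋₊ + 1) ≤ interpSum f y := by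
  have hle {z : ℝ} (hz : min y (⌊x⌋₊ + 1) ≤ z) :
      interpSum f x + (min y (⌊x⌋₊ + 1) - x) * f (⌊x⌋₊ + 1)
        ≤ ∑ n ∈ Icc 1 ⌊x⌋₊, f n + (z - ⌊x⌋₊) * f (⌊x⌋₊ + 1) := by
    rw [interpSum, add_assoc, ← add_mul]
    gcongr
    · exact hf _
    · linarith
  rcases (Nat.floor_le_floor hxy).eq_or_lt with hfloor | hfloor
  · exact (hle (min_le_left _ _)).trans_eq (by rw [interpSum, hfloor])
  · refine (hle (min_le_right _ _)).trans ?_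
    rw [add_sub_cancel_left, one_mul, ← sum_Icc_succ_top (by lia)]
    exact sum_Icc_le_interpSum hf (hx.trans hxy) hfloor

theorem interpSum_mono (hf : ∀ n, 0 ≤ f n) (hx : 0 ≤ x) (hxy : x ≤ y) :
    interpSum f x ≤ interpSum f y := by
  have hmin : x ≤ min y (⌊x⌋₊ + 1) := le_min hxy (Nat.lt_floor_add_one x).le
  have hadd := interpSum_add_mul_le hf hx hxy
  have hnonneg := mul_nonneg (sub_nonneg.2 hmin) (hf (⌊x⌋₊ + 1))
  linarith

theorem strictMonoOn_interpSum (hf : ∀ n, 0 < f n) : StrictMonoOn (interpSum f) (Set.Ici 0) := by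
  intro x hx y _ hxy
  have hmin : x < min y (⌊x⌋₊ + 1) := lt_min hxy (Nat.lt_floor_add_one x)
  have hadd := interpSum_add_mul_le (fun n => (hf n).le) hx hxy.le
  have hpos := mul_pos (sub_pos.2 hmin) (hf (⌊x⌋₊ + 1))
  linarith

theorem exists_interpSum_eq (hf : ∀ n, 0 ≤ f n) (hdiv : ¬ Summable f) {c : ℝ} (hc : 0 ≤ c) :
    ∃ x, 0 ≤ x ∧ interpSum f x = c := by
  have hexceed : ∃ n, c < ∑ k ∈ Icc 1 n, f k := by
    by_contra! hbdd
    refine hdiv ((summable_nat_add_iff 1).1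
      (summable_of_sum_range_le (fun n => hf (n + 1)) fun n => (?_ : _ ≤ c)))
    rw [range_eq_Ico, sum_Ico_add' f 0 n 1]
    exact hbdd n
  obtain ⟨m, hm⟩ : ∃ m, Nat.find hexceed = m + 1 :=
    Nat.exists_eq_succ_of_ne_zero fun hzero => by
      have hspec := Nat.find_spec hexceed
      rw [hzero, Icc_eq_empty_of_lt zero_lt_one, sum_empty] at hspec
      exact hspec.not_ge hc
  have hlow : ∑ k ∈ Icc 1 m, f k ≤ c := not_lt.1 (Nat.find_min hexceed (by lia))
  have hhigh : c < ∑ k ∈ Icc 1 m, f k + f (m + 1) := by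
    rw [← sum_Icc_succ_top (by lia), ← hm]
    exact Nat.find_spec hexceed
  have hpos : 0 < f (m + 1) := by linarith
  set t := (c - ∑ k ∈ Icc 1 m, f k) / f (m + 1)
  have ht_nonneg : 0 ≤ t := div_nonneg (sub_nonneg.2 hlow) hpos.le
  have ht_lt : t < 1 := (div_lt_one hpos).2 (by linarith)
  have hfloor : ⌊m + t⌋₊ = m := (Nat.floor_eq_iff (by positivity)).2 ⟨by linarith, by linarith⟩
  refine ⟨m + t, by positivity, ?_⟩
  rw [interpSum, hfloor, add_sub_cancel_left, div_mul_cancel₀ _ hpos.ne', add_sub_cancel]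

theorem truncNormSq_eq_interpSum (L : ℝ) (φ : ℕ+ → ℂ) :
    truncNormSq L φ = interpSum (fun n => ‖ext φ n‖ ^ 2) L :=
  rfl

theorem sq_transferNorm (a b : ℕ → ℝ) (E : ℝ) {L : ℝ} (hL : 1 ≤ L) :
    transferNorm a b E L ^ 2 = interpSum (fun n => opNorm (transfer a b n E) ^ 2) (L - 1) := by
  have hfloor : 1 ≤ ⌊L⌋₊ := Nat.le_floor (by exact_mod_cast hL)
  have hfrac : 0 ≤ L - ⌊L⌋₊ := sub_nonneg.2 (Nat.floor_le (zero_le_one.trans hL))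
  rw [transferNorm, Real.sq_sqrt (by positivity), interpSum, Nat.floor_sub_one,
    Nat.sub_add_cancel hfloor, Nat.cast_sub hfloor, Nat.cast_one]
  ring

end InterpSum

/-! ## Operator norms of real `2 × 2` matrices -/

section OpNorm

open Matrix
open scoped Matrix.Norms.L2Operator

/-- The square of the Frobenius norm. -/
def frobSq (M : Matrix (Fin 2) (Fin 2) ℝ) : ℝ := ∑ i, ∑ j, M i j ^ 2

theorem opNorm_nonneg (M : Matrix (Fin 2) (Fin 2) ℝ) : 0 ≤ opNorm M := norm_nonneg _

theorem opNorm_pos {M : Matrix (Fin 2) (Fin 2) ℝ} (hM : M ≠ 0) : 0 < opNorm M :=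
  norm_pos_iff.2 ((map_ne_zero_iff _ (toEuclideanCLM (𝕜 := ℝ)).injective).2 hM)

theorem opNorm_smul (c : ℝ) (M : Matrix (Fin 2) (Fin 2) ℝ) : opNorm (c • M) = |c| * opNorm M := by
  rw [opNorm, map_smul, norm_smul, Real.norm_eq_abs, opNorm]

theorem opNorm_transpose (M : Matrix (Fin 2) (Fin 2) ℝ) : opNorm Mᵀ = opNorm M :=
  l2_opNorm_conjTranspose M

theorem sum_sq_mulVec_le (M : Matrix (Fin 2) (Fin 2) ℝ) (v : Fin 2 → ℝ) :
    ∑ i, (M *ᵥ v) i ^ 2 ≤ opNorm M ^ 2 * ∑ i, v i ^ 2 := by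
  have hle := pow_le_pow_left₀ (norm_nonneg _) (l2_opNorm_mulVec M (WithLp.toLp 2 v)) 2
  rw [mul_pow, EuclideanSpace.real_norm_sq_eq, EuclideanSpace.real_norm_sq_eq] at hle
  exact hle

theorem sum_sq_col_le (M : Matrix (Fin 2) (Fin 2) ℝ) (j : Fin 2) :
    ∑ i, M i j ^ 2 ≤ opNorm M ^ 2 := by
  simpa [Pi.single_apply] using sum_sq_mulVec_le M (Pi.single j 1)

theorem sum_sq_row_le (M : Matrix (Fin 2) (Fin 2) ℝ) (i : Fin 2) :
    ∑ j, M i j ^ 2 ≤ opNorm M ^ 2 :=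
  opNorm_transpose M ▸ sum_sq_col_le Mᵀ i

theorem abs_det_le_sq_opNorm (M : Matrix (Fin 2) (Fin 2) ℝ) : |M.det| ≤ opNorm M ^ 2 := by
  have hrow₀ := sum_sq_row_le M 0
  have hrow₁ := sum_sq_row_le M 1
  rw [Fin.sum_univ_two] at hrow₀ hrow₁
  rw [det_fin_two, abs_le]
  constructor <;> nlinarith [sq_nonneg (M 0 0 + M 1 1), sq_nonneg (M 0 1 - M 1 0),
    sq_nonneg (M 0 0 - M 1 1), sq_nonneg (M 0 1 + M 1 0)]

theorem frobSq_nonneg (M : Matrix (Fin 2) (Fin 2) ℝ) : 0 ≤ frobSq M :=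
  Finset.sum_nonneg fun _ _ => Finset.sum_nonneg fun _ _ => sq_nonneg _

theorem frobSq_adjugate (M : Matrix (Fin 2) (Fin 2) ℝ) : frobSq M.adjugate = frobSq M := by
  simp only [frobSq, adjugate_fin_two, Fin.sum_univ_two, of_apply, cons_val', cons_val_zero,
    cons_val_one, cons_val_fin_one]
  ring

theorem frobSq_mul_le (M N : Matrix (Fin 2) (Fin 2) ℝ) :
    frobSq (M * N) ≤ opNorm M ^ 2 * frobSq N := by
  rw [frobSq, frobSq, Finset.sum_comm, Finset.sum_comm (f := fun i j => N i j ^ 2), Finset.mul_sum]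
  exact Finset.sum_le_sum fun j _ => sum_sq_mulVec_le M fun i => N i j

theorem sq_opNorm_le_frobSq (M : Matrix (Fin 2) (Fin 2) ℝ) : opNorm M ^ 2 ≤ frobSq M := by
  refine (Real.le_sqrt (opNorm_nonneg M) (frobSq_nonneg M)).1 ?_
  refine ContinuousLinearMap.opNorm_le_bound _ (Real.sqrt_nonneg _) fun v => ?_
  refine (sq_le_sq₀ (norm_nonneg _) (by positivity)).1 ?_
  rw [mul_pow, Real.sq_sqrt (frobSq_nonneg M), EuclideanSpace.real_norm_sq_eq,
    EuclideanSpace.real_norm_sq_eq, frobSq, Finset.sum_mul]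
  exact Finset.sum_le_sum fun i _ => Finset.sum_mul_sq_le_sq_mul_sq Finset.univ (M i) v

theorem sq_opNorm_mul_sq_det_le (M N : Matrix (Fin 2) (Fin 2) ℝ) :
    opNorm M ^ 2 * N.det ^ 2 ≤ frobSq (M * N) * frobSq N := by
  calc opNorm M ^ 2 * N.det ^ 2
      = opNorm (M * N * N.adjugate) ^ 2 := by
        rw [mul_assoc, mul_adjugate, mul_smul_comm, mul_one, opNorm_smul, mul_pow, sq_abs, mul_comm]
    _ ≤ opNorm (M * N) ^ 2 * frobSq N.adjugate :=
        (sq_opNorm_le_frobSq _).trans (frobSq_mul_le _ _)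
    _ ≤ frobSq (M * N) * frobSq N := by
        rw [frobSq_adjugate]
        exact mul_le_mul_of_nonneg_right (sq_opNorm_le_frobSq _) (frobSq_nonneg N)

/-- A vector in `ℂ²` as a real matrix, with its real and imaginary parts as columns. -/
def reImMatrix (v : EuclideanSpace ℂ (Fin 2)) : Matrix (Fin 2) (Fin 2) ℝ :=
  of fun i => ![(v i).re, (v i).im]

theorem frobSq_reImMatrix (v : EuclideanSpace ℂ (Fin 2)) : frobSq (reImMatrix v) = ‖v‖ ^ 2 := by
  simp only [frobSq, reImMatrix, EuclideanSpace.norm_sq_eq, Fin.sum_univ_two, Complex.sq_norm,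
    Complex.normSq_apply, of_apply, cons_val_zero, cons_val_one]
  ring

theorem reImMatrix_toEuclideanCLM (M : Matrix (Fin 2) (Fin 2) ℝ) (v : EuclideanSpace ℂ (Fin 2)) :
    reImMatrix (toEuclideanCLM (𝕜 := ℂ) (M.map Complex.ofReal) v) = M * reImMatrix v := by
  ext i j
  fin_cases j <;> simp [reImMatrix, mul_apply, mulVec, dotProduct]

end OpNorm

/-! ## Transfer matrices -/

section Transfer

variable {a b : ℕ → ℝ}

theorem det_transfer (ha : ∀ n, a n ≠ 0) (ha0 : a 0 = 1) (E : ℝ) (n : ℕ) :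
    (transfer a b n E).det = (a n)⁻¹ := by
  refine eq_inv_of_mul_eq_one_right ?_
  rw [transfer, Matrix.det_fin_two_of]
  induction n with
  | zero => simp [uSol, ha0]
  | succ n ih =>
    have hcos := uSol_eq a b ha 0 E (n + 1) (by lia)
    have hsin := uSol_eq a b ha (Real.pi / 2) E (n + 1) (by lia)
    rw [Nat.add_sub_cancel] at hcos hsin
    linear_combination ih + uSol a b (Real.pi / 2) E (n + 1) * hcos - uSol a b 0 E (n + 1) * hsin

theorem inv_abs_le_sq_opNorm_transfer (ha : ∀ n, a n ≠ 0) (ha0 : a 0 = 1) (E : ℝ) (n : ℕ) :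
    |a n|⁻¹ ≤ opNorm (transfer a b n E) ^ 2 := by
  rw [← abs_inv, ← det_transfer (b := b) ha ha0 E n]
  exact abs_det_le_sq_opNorm _

theorem opNorm_inv_transfer_pos (ha : ∀ n, a n ≠ 0) (ha0 : a 0 = 1) (E : ℝ) (n : ℕ) :
    0 < opNorm (transfer a b n E)⁻¹ := by
  refine opNorm_pos fun hzero => ha n ?_
  have hdet := det_transfer (b := b) ha ha0 E n
  rw [← inv_eq_zero, ← hdet, ← inv_eq_zero, ← Ring.inverse_eq_inv', ← Matrix.det_nonsing_inv, hzero,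
    Matrix.det_zero]

theorem scaleTilde_spec (ha : ∀ n, a n ≠ 0) (ha0 : a 0 = 1)
    (hsum : ¬ Summable fun n : ℕ => |a (n + 1)|⁻¹) (E : ℝ) {ε : ℝ} (hε : 0 < ε) :
    1 ≤ scaleTilde a b ε E ∧ transferNorm a b E (scaleTilde a b ε E)
      = 2 * opNorm (transfer a b 1 E)⁻¹ * ε⁻¹ := by
  set c := 2 * opNorm (transfer a b 1 E)⁻¹ * ε⁻¹ with hc
  have hc_nonneg : 0 ≤ c := mul_nonneg (mul_nonneg two_pos.le (opNorm_nonneg _)) (inv_pos.2 hε).le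
  have hpos (n : ℕ) : 0 < opNorm (transfer a b n E) ^ 2 :=
    (inv_pos.2 (abs_pos.2 (ha n))).trans_le (inv_abs_le_sq_opNorm_transfer ha ha0 E n)
  have hdiv : ¬ Summable fun n => opNorm (transfer a b n E) ^ 2 := fun hsummable =>
    hsum (((summable_nat_add_iff 1).2 hsummable).of_nonneg_of_le (fun n => by positivity)
      fun n => inv_abs_le_sq_opNorm_transfer ha ha0 E (n + 1))
  have hmem {L : ℝ} (hL : 1 ≤ L) : transferNorm a b E L = c ↔
      interpSum (fun n => opNorm (transfer a b n E) ^ 2) (L - 1) = c ^ 2 := by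
    rw [← sq_transferNorm a b E hL, pow_left_inj₀
      (show 0 ≤ transferNorm a b E L from Real.sqrt_nonneg _) hc_nonneg two_ne_zero]
  obtain ⟨x, hx, hxc⟩ := exists_interpSum_eq (fun n => (hpos n).le) hdiv (sq_nonneg c)
  have hset : {L : ℝ | 1 ≤ L ∧ transferNorm a b E L = c} = {x + 1} := by
    refine Set.eq_singleton_iff_unique_mem.2 ⟨⟨by linarith, ?_⟩, fun L ⟨hL, hLc⟩ => ?_⟩
    · rwa [hmem (by linarith), add_sub_cancel_right]
    · rw [hmem hL, ← hxc] at hLc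
      have hLx := (strictMonoOn_interpSum hpos).injOn (sub_nonneg.2 hL) hx hLc
      linarith
  have hscale : scaleTilde a b ε E ∈ {L : ℝ | 1 ≤ L ∧ transferNorm a b E L = c} := by
    rw [scaleTilde, ← hc, hset, csInf_singleton]
    exact Set.mem_singleton _
  exact hscale

end Transfer

/-! ## Solutions at complex energies -/

section Solution

variable {a b : ℕ → ℝ} {z : ℂ} {u : ℕ → ℂ}

/-- `u` solves `a(n) u(n+1) + a(n-1) u(n-1) + b(n) u(n) = z u(n)` for `n ≥ 1`; the equation is
shifted by one index to avoid truncated subtraction. -/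
def IsSolution (a b : ℕ → ℝ) (z : ℂ) (u : ℕ → ℂ) : Prop :=
  ∀ n, a (n + 1) * u (n + 2) + a n * u n + b (n + 1) * u (n + 1) = z * u (n + 1)

/-- The flux (imaginary part of the Wronskian of `u` and `ū`) `a(n) Im (u(n+1) ū(n))`. -/
def flux (a : ℕ → ℝ) (u : ℕ → ℂ) (n : ℕ) : ℝ := a n * (u (n + 1) * conj (u n)).im

/-- The Cauchy data `(u(n+1), u(n))`. -/
def cauchyData (u : ℕ → ℂ) (n : ℕ) : EuclideanSpace ℂ (Fin 2) := !₂[u (n + 1), u n]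

/-- The coordinates `Φ(n, E)⁻¹ (u(n+1), u(n))` of `u` with respect to the solutions `u_0`, `u_{π/2}`
at the real energy `E`; they do not depend on `n` if `u` is itself a solution at the energy `E`. -/
def coords (a b : ℕ → ℝ) (E : ℝ) (u : ℕ → ℂ) (n : ℕ) : EuclideanSpace ℂ (Fin 2) :=
  Matrix.toEuclideanCLM (𝕜 := ℂ) ((transfer a b n E)⁻¹.map Complex.ofReal) (cauchyData u n)

theorem sq_norm_cauchyData (u : ℕ → ℂ) (n : ℕ) :
    ‖cauchyData u n‖ ^ 2 = ‖u (n + 1)‖ ^ 2 + ‖u n‖ ^ 2 := by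
  simp [cauchyData, EuclideanSpace.norm_sq_eq]

theorem reImMatrix_coords (E : ℝ) (n : ℕ) :
    reImMatrix (coords a b E u n) = (transfer a b n E)⁻¹ * reImMatrix (cauchyData u n) :=
  reImMatrix_toEuclideanCLM _ _

theorem sq_norm_coords_le_mul (E : ℝ) (n : ℕ) :
    ‖coords a b E u n‖ ^ 2 ≤ opNorm (transfer a b n E)⁻¹ ^ 2 * (‖u (n + 1)‖ ^ 2 + ‖u n‖ ^ 2) := by
  rw [← sq_norm_cauchyData, ← frobSq_reImMatrix, ← frobSq_reImMatrix, reImMatrix_coords]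
  exact frobSq_mul_le _ _

theorem coords_eq (ha : ∀ n, a n ≠ 0) (ha0 : a 0 = 1) (E : ℝ) (n : ℕ) :
    coords a b E u n = (a n : ℂ) •
      !₂[uSol a b (Real.pi / 2) E n * u (n + 1) - uSol a b (Real.pi / 2) E (n + 1) * u n,
        uSol a b 0 E (n + 1) * u n - uSol a b 0 E n * u (n + 1)] := by
  have hinv : (transfer a b n E)⁻¹ = a n • (transfer a b n E).adjugate := by
    rw [Matrix.inv_def, det_transfer ha ha0, Ring.inverse_eq_inv', inv_inv]
  rw [coords, hinv, transfer, Matrix.adjugate_fin_two_of, cauchyData,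
    Matrix.toEuclideanCLM_toLp, Matrix.mulVec_fin_two]
  ext i
  fin_cases i <;> simp <;> ring

theorem coords_succ_sub (ha : ∀ n, a n ≠ 0) (ha0 : a 0 = 1) (E : ℝ) (hu : IsSolution a b z u)
    (n : ℕ) :
    coords a b E u (n + 1) - coords a b E u n = ((z - E) * u (n + 1)) •
      !₂[(uSol a b (Real.pi / 2) E (n + 1) : ℂ), -(uSol a b 0 E (n + 1) : ℂ)] := by
  have huSol (θ : ℝ) : (a (n + 1) : ℂ) * uSol a b θ E (n + 2) + a n * uSol a b θ E n
      + b (n + 1) * uSol a b θ E (n + 1) = E * uSol a b θ E (n + 1) :=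
    mod_cast uSol_eq a b ha θ E (n + 1) le_add_self
  rw [coords_eq ha ha0, coords_eq ha ha0]
  ext i
  fin_cases i
  · simp only [Complex.coe_smul, Fin.zero_eta, PiLp.sub_apply, PiLp.smul_apply,
      Matrix.cons_val_zero, Complex.real_smul, smul_eq_mul]
    linear_combination uSol a b (Real.pi / 2) E (n + 1) * hu n - u (n + 1) * huSol (Real.pi / 2)
  · simp only [Complex.coe_smul, Fin.mk_one, PiLp.sub_apply, PiLp.smul_apply,
      Matrix.cons_val_one, Matrix.cons_val_fin_one, Complex.real_smul, smul_eq_mul, mul_neg]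
    linear_combination u (n + 1) * huSol 0 - uSol a b 0 E (n + 1) * hu n

theorem norm_coords_succ_sub_le (ha : ∀ n, a n ≠ 0) (ha0 : a 0 = 1) (E : ℝ)
    (hu : IsSolution a b z u) (n : ℕ) :
    ‖coords a b E u (n + 1) - coords a b E u n‖
      ≤ ‖z - E‖ * (‖u (n + 1)‖ * opNorm (transfer a b n E)) := by
  rw [coords_succ_sub ha ha0 E hu, norm_smul, norm_mul, mul_assoc]
  have hrow := sum_sq_row_le (transfer a b n E) 0
  gcongr
  refine (sq_le_sq₀ (norm_nonneg _) (opNorm_nonneg _)).1 (le_trans (le_of_eq ?_) hrow)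
  simp [EuclideanSpace.norm_sq_eq, transfer, add_comm]

theorem sq_norm_coords_le (ha : ∀ n, a n ≠ 0) (ha0 : a 0 = 1) (E : ℝ) (hu : IsSolution a b z u)
    {n : ℕ} (hn : 1 ≤ n) :
    ‖coords a b E u n‖ ^ 2 ≤ 2 * ‖coords a b E u 1‖ ^ 2 + 2 * ‖z - E‖ ^ 2 *
      ((∑ k ∈ Finset.Ico 1 n, ‖u (k + 1)‖ ^ 2)
        * ∑ k ∈ Finset.Ico 1 n, opNorm (transfer a b k E) ^ 2) := by
  set D := ∑ k ∈ Finset.Ico 1 n, ‖u (k + 1)‖ * opNorm (transfer a b k E)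
  have hsub : ‖coords a b E u n - coords a b E u 1‖ ≤ ‖z - E‖ * D := by
    rw [← Finset.sum_Ico_sub _ hn, Finset.mul_sum]
    exact norm_sum_le_of_le _ fun k _ => norm_coords_succ_sub_le ha ha0 E hu k
  have hnorm : ‖coords a b E u n‖ ≤ ‖coords a b E u 1‖ + ‖z - E‖ * D :=
    (norm_le_norm_add_norm_sub' _ _).trans (by gcongr)
  calc ‖coords a b E u n‖ ^ 2 ≤ (‖coords a b E u 1‖ + ‖z - E‖ * D) ^ 2 := by gcongr
    _ ≤ 2 * (‖coords a b E u 1‖ ^ 2 + (‖z - E‖ * D) ^ 2) := add_sq_le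
    _ = 2 * ‖coords a b E u 1‖ ^ 2 + 2 * ‖z - E‖ ^ 2 * D ^ 2 := by ring
    _ ≤ _ := by
      gcongr
      exact Finset.sum_mul_sq_le_sq_mul_sq _ _ _

theorem flux_eq_add_sum (hu : IsSolution a b z u) (n : ℕ) :
    flux a u n = flux a u 0 + z.im * ∑ k ∈ Finset.Icc 1 n, ‖u k‖ ^ 2 := by
  induction n with
  | zero => simp
  | succ n ih =>
    have him := congrArg (fun w => (w * conj (u (n + 1))).im) (hu n)
    simp only [Complex.mul_im, Complex.add_im, Complex.add_re, Complex.mul_re, Complex.conj_re,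
      Complex.conj_im, Complex.ofReal_re, Complex.ofReal_im] at him
    rw [Finset.sum_Icc_succ_top (by lia), mul_add, ← add_assoc, ← ih, Complex.sq_norm,
      Complex.normSq_apply]
    simp only [flux, Complex.mul_im, Complex.conj_re, Complex.conj_im]
    linear_combination him

theorem det_reImMatrix_coords (ha : ∀ n, a n ≠ 0) (ha0 : a 0 = 1) (E : ℝ) (n : ℕ) :
    (reImMatrix (coords a b E u n)).det = -flux a u n := by
  rw [reImMatrix_coords, Matrix.det_mul, Matrix.det_nonsing_inv, det_transfer ha ha0,
    Ring.inverse_eq_inv', inv_inv, Matrix.det_fin_two]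
  simp only [reImMatrix, cauchyData, flux, Matrix.of_apply, Matrix.cons_val_zero,
    Matrix.cons_val_one, Matrix.cons_val_fin_one, Complex.mul_im, Complex.conj_im, Complex.conj_re]
  ring

theorem sq_opNorm_transfer_mul_sq_flux_le (ha : ∀ n, a n ≠ 0) (ha0 : a 0 = 1) (E : ℝ) (n : ℕ) :
    opNorm (transfer a b n E) ^ 2 * flux a u n ^ 2
      ≤ (‖u (n + 1)‖ ^ 2 + ‖u n‖ ^ 2) * ‖coords a b E u n‖ ^ 2 := by
  have hdet : IsUnit (transfer a b n E).det := by
    rw [det_transfer ha ha0]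
    exact (inv_ne_zero (ha n)).isUnit
  have hmul : transfer a b n E * reImMatrix (coords a b E u n) = reImMatrix (cauchyData u n) := by
    rw [reImMatrix_coords, Matrix.mul_nonsing_inv_cancel_left _ _ hdet]
  have hle := sq_opNorm_mul_sq_det_le (transfer a b n E) (reImMatrix (coords a b E u n))
  rwa [det_reImMatrix_coords ha ha0, neg_sq, hmul, frobSq_reImMatrix, frobSq_reImMatrix,
    sq_norm_cauchyData] at hle

theorem interpSum_succ_le {f : ℕ → ℝ} (hf : ∀ n, 0 ≤ f n) {L : ℝ} (hL : 1 ≤ L) :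
    interpSum (fun n => f (n + 1)) (L - 1) ≤ interpSum f L := by
  have hadd := interpSum_add_one f (sub_nonneg.2 hL)
  rw [sub_add_cancel] at hadd
  linarith [hf 1]

theorem mul_sq_transferNorm_le (ha : ∀ n, a n ≠ 0) (ha0 : a 0 = 1) {E L c B : ℝ} (hL : 1 ≤ L)
    (hflux : ∀ n ∈ Finset.Icc 1 ⌊L⌋₊, c ≤ flux a u n ^ 2)
    (hcoords : ∀ n ∈ Finset.Icc 1 ⌊L⌋₊, ‖coords a b E u n‖ ^ 2 ≤ B) :
    c * transferNorm a b E L ^ 2 ≤ B * (2 * interpSum (fun n => ‖u n‖ ^ 2) L) := by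
  have hone : 1 ∈ Finset.Icc 1 ⌊L⌋₊ := Finset.mem_Icc.2 ⟨le_rfl, Nat.one_le_floor_iff L |>.2 hL⟩
  have hB : 0 ≤ B := (sq_nonneg _).trans (hcoords 1 hone)
  have hpair : interpSum (fun n => ‖u (n + 1)‖ ^ 2 + ‖u n‖ ^ 2) (L - 1)
      ≤ 2 * interpSum (fun n => ‖u n‖ ^ 2) L := by
    rw [interpSum_add, two_mul]
    exact add_le_add (interpSum_succ_le (f := fun n => ‖u n‖ ^ 2) (fun _ => sq_nonneg _) hL)
      (interpSum_mono (fun _ => sq_nonneg _) (sub_nonneg.2 hL) (sub_le_self L zero_le_one))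
  refine le_trans ?_ (mul_le_mul_of_nonneg_left hpair hB)
  rw [sq_transferNorm a b E hL, ← interpSum_const_mul, ← interpSum_const_mul]
  refine interpSum_le_interpSum (sub_nonneg.2 hL) fun n hn => ?_
  rw [Nat.floor_sub_one, Nat.sub_add_cancel (Finset.mem_Icc.1 hone).2] at hn
  calc c * opNorm (transfer a b n E) ^ 2 ≤ flux a u n ^ 2 * opNorm (transfer a b n E) ^ 2 := by
        gcongr
        exact hflux n hn
    _ ≤ (‖u (n + 1)‖ ^ 2 + ‖u n‖ ^ 2) * ‖coords a b E u n‖ ^ 2 := by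
        rw [mul_comm]
        exact sq_opNorm_transfer_mul_sq_flux_le ha ha0 E n
    _ ≤ B * (‖u (n + 1)‖ ^ 2 + ‖u n‖ ^ 2) := by
        rw [mul_comm]
        gcongr
        exact hcoords n hn

theorem sq_norm_coords_le_of_interpSum_le (ha : ∀ n, a n ≠ 0) (ha0 : a 0 = 1) {E ε L m : ℝ}
    (hε : 0 < ε) (hzE : ‖z - E‖ ^ 2 ≤ 2 * ε ^ 2) (hu : IsSolution a b z u)
    (hm : ‖u 1‖ ^ 2 + ‖u 2‖ ^ 2 ≤ m) (hL : 1 ≤ L)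
    (hΦ : transferNorm a b E L = 2 * opNorm (transfer a b 1 E)⁻¹ * ε⁻¹)
    (hmass : interpSum (fun k => ‖u k‖ ^ 2) L ≤ m / 8) {n : ℕ} (hn : n ∈ Finset.Icc 1 ⌊L⌋₊) :
    ‖coords a b E u n‖ ^ 2 ≤ 4 * opNorm (transfer a b 1 E)⁻¹ ^ 2 * m := by
  obtain ⟨hn_one, hn_floor⟩ := Finset.mem_Icc.1 hn
  set p := opNorm (transfer a b 1 E)⁻¹
  have hpred : n - 1 ≤ ⌊L - 1⌋₊ := by rw [Nat.floor_sub_one]; lia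
  have hIco : Finset.Ico 1 n = Finset.Icc 1 (n - 1) := by ext; simp; lia
  have hΦ_sum : ∑ k ∈ Finset.Ico 1 n, opNorm (transfer a b k E) ^ 2 ≤ (2 * p * ε⁻¹) ^ 2 := by
    rw [← hΦ, sq_transferNorm a b E hL, hIco]
    exact sum_Icc_le_interpSum (fun _ => sq_nonneg _) (sub_nonneg.2 hL) hpred
  have hu_sum : ∑ k ∈ Finset.Ico 1 n, ‖u (k + 1)‖ ^ 2 ≤ m / 8 := by
    rw [hIco]
    exact (sum_Icc_le_interpSum (fun _ => sq_nonneg _) (sub_nonneg.2 hL) hpred).trans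
      ((interpSum_succ_le (f := fun k => ‖u k‖ ^ 2) (fun _ => sq_nonneg _) hL).trans hmass)
  have hcoords_one : ‖coords a b E u 1‖ ^ 2 ≤ p ^ 2 * m :=
    (sq_norm_coords_le_mul E 1).trans (by gcongr; linarith)
  have hm_nonneg : 0 ≤ m := le_trans (by positivity) hm
  calc ‖coords a b E u n‖ ^ 2
      ≤ 2 * (p ^ 2 * m) + 2 * (2 * ε ^ 2) * (m / 8 * (2 * p * ε⁻¹) ^ 2) :=
        (sq_norm_coords_le ha ha0 E hu hn_one).trans (by gcongr)
    _ = 4 * p ^ 2 * m := by field_simp; ring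

theorem le_interpSum_of_transferNorm_eq (ha : ∀ n, a n ≠ 0) (ha0 : a 0 = 1) {E ε L m : ℝ}
    (hε : 0 < ε) (hz : z.im = ε) (hzE : ‖z - E‖ ^ 2 ≤ 2 * ε ^ 2) (hu : IsSolution a b z u)
    (hflux : flux a u 0 = -(ε * m)) (hm : ‖u 1‖ ^ 2 + ‖u 2‖ ^ 2 ≤ m) (hL : 1 ≤ L)
    (hΦ : transferNorm a b E L = 2 * opNorm (transfer a b 1 E)⁻¹ * ε⁻¹) :
    m / 8 ≤ interpSum (fun n => ‖u n‖ ^ 2) L := by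
  by_contra! hlt
  set s := interpSum (fun n => ‖u n‖ ^ 2) L
  set p := opNorm (transfer a b 1 E)⁻¹
  have hp : 0 < p := opNorm_inv_transfer_pos ha ha0 E 1
  have hsum_le {n : ℕ} (hn : n ≤ ⌊L⌋₊) : ∑ k ∈ Finset.Icc 1 n, ‖u k‖ ^ 2 ≤ s :=
    sum_Icc_le_interpSum (fun _ => sq_nonneg _) (by linarith) hn
  have hm_pos : 0 < m := by
    have hs : 0 ≤ s := by simpa using hsum_le (Nat.zero_le _)
    linarith
  have hflux_le {n : ℕ} (hn : n ≤ ⌊L⌋₊) : flux a u n ≤ -(ε * (m / 2)) := by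
    rw [flux_eq_add_sum hu, hflux, hz]
    nlinarith [mul_le_mul_of_nonneg_left (hsum_le hn) hε.le]
  have hflux_sq (n : ℕ) (hn : n ∈ Finset.Icc 1 ⌊L⌋₊) : (ε * (m / 2)) ^ 2 ≤ flux a u n ^ 2 := by
    rw [← neg_sq (flux a u n)]
    exact pow_le_pow_left₀ (by positivity) (le_neg.2 (hflux_le (Finset.mem_Icc.1 hn).2)) 2
  have hgrowth := mul_sq_transferNorm_le ha ha0 hL hflux_sq fun n hn =>
    sq_norm_coords_le_of_interpSum_le ha ha0 hε hzE hu hm hL hΦ hlt.le hn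
  refine hgrowth.not_gt ?_
  calc 4 * p ^ 2 * m * (2 * s) < 4 * p ^ 2 * m * (2 * (m / 8)) := by gcongr
    _ = (ε * (m / 2)) ^ 2 * transferNorm a b E L ^ 2 := by rw [hΦ]; field_simp; ring

end Solution

/-! ## Poisson averages -/

section Poisson

variable {ε : ℝ}

/-- The Poisson kernel of the upper half-plane at the point `E + iε`, without the factor `1/π`. -/
def poissonKernel (ε E x : ℝ) : ℝ := ε / ((x - E) ^ 2 + ε ^ 2)

theorem im_inv_sub (ε E x : ℝ) : ((x - (E + ε * Complex.I) : ℂ)⁻¹).im = poissonKernel ε E x := by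
  simp [Complex.inv_im, Complex.normSq_apply, poissonKernel, sq]

theorem norm_inv_sub_le (hε : 0 < ε) (E x : ℝ) : ‖(x - (E + ε * Complex.I) : ℂ)⁻¹‖ ≤ ε⁻¹ := by
  rw [norm_inv]
  refine inv_anti₀ hε ((Complex.abs_im_le_norm _).trans' ?_)
  simp [abs_of_pos hε]

theorem integrable_inv_sub {μ : Measure ℝ} [IsFiniteMeasure μ] (hε : 0 < ε) (E : ℝ) :
    Integrable (fun x : ℝ => (x - (E + ε * Complex.I) : ℂ)⁻¹) μ :=
  .of_bound (by fun_prop) ε⁻¹ (Eventually.of_forall (norm_inv_sub_le hε E))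

theorem integrable_poissonKernel {μ : Measure ℝ} [IsFiniteMeasure μ] (hε : 0 < ε) (E : ℝ) :
    Integrable (poissonKernel ε E) μ :=
  (integrable_inv_sub hε E).im.congr (Eventually.of_forall (im_inv_sub ε E))

theorem im_integral_inv_sub {μ : Measure ℝ} [IsFiniteMeasure μ] (hε : 0 < ε) (E : ℝ) :
    (∫ x : ℝ, (x - (E + ε * Complex.I) : ℂ)⁻¹ ∂μ).im = ∫ x, poissonKernel ε E x ∂μ :=
  (integral_im (integrable_inv_sub hε E)).symm.trans
    (integral_congr_ae (Eventually.of_forall (im_inv_sub ε E)))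

theorem poissonKernel_nonneg (hε : 0 < ε) (E x : ℝ) : 0 ≤ poissonKernel ε E x := by
  unfold poissonKernel
  positivity

theorem inv_two_mul_le_poissonKernel (hε : 0 < ε) {E x : ℝ} (hE : |E - x| ≤ ε) :
    (2 * ε)⁻¹ ≤ poissonKernel ε E x := by
  have hsq : (x - E) ^ 2 ≤ ε ^ 2 := by
    rw [← neg_sub, neg_sq]
    exact sq_le_sq' (abs_le.1 hE).1 (abs_le.1 hE).2
  rw [poissonKernel, inv_eq_one_div, div_le_div_iff₀ (by positivity) (by positivity)]
  nlinarith

theorem one_le_setLIntegral_poissonKernel (hε : 0 < ε) {D : Set ℝ} {x : ℝ}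
    (hD : Metric.ball x ε ⊆ D) : 1 ≤ ∫⁻ E in D, ENNReal.ofReal (poissonKernel ε E x) :=
  calc (1 : ENNReal) = ENNReal.ofReal (2 * ε)⁻¹ * volume (Metric.ball x ε) := by
        rw [Real.volume_ball, ← ENNReal.ofReal_mul (by positivity),
          inv_mul_cancel₀ (by positivity), ENNReal.ofReal_one]
    _ = ∫⁻ _ in Metric.ball x ε, ENNReal.ofReal (2 * ε)⁻¹ := (setLIntegral_const _ _).symm
    _ ≤ ∫⁻ E in Metric.ball x ε, ENNReal.ofReal (poissonKernel ε E x) :=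
        setLIntegral_mono' measurableSet_ball fun E hE =>
          ENNReal.ofReal_le_ofReal (inv_two_mul_le_poissonKernel hε (Metric.mem_ball.1 hE).le)
    _ ≤ _ := lintegral_mono_set hD

theorem measureReal_le_integral_of_poissonKernel_le {μ : Measure ℝ} [IsFiniteMeasure μ]
    (hε : 0 < ε) {S : Set ℝ} {h : ℝ → ℝ} (hh : Integrable h) (hh_nonneg : ∀ E, 0 ≤ h E)
    (hS : ∀ E ∈ Metric.thickening ε S, ∫ x, poissonKernel ε E x ∂μ ≤ h E) :
    μ.real S ≤ ∫ E, h E := by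
  set D := Metric.thickening ε S
  have hD : MeasurableSet D := Metric.isOpen_thickening.measurableSet
  have hmeas : Measurable fun p : ℝ × ℝ => ENNReal.ofReal (poissonKernel ε p.2 p.1) := by
    unfold poissonKernel
    fun_prop
  have hbound {E : ℝ} (hE : E ∈ D) :
      ∫⁻ x, ENNReal.ofReal (poissonKernel ε E x) ∂μ ≤ ENNReal.ofReal (h E) := by
    rw [← ofReal_integral_eq_lintegral_ofReal (integrable_poissonKernel hε E)
      (Eventually.of_forall (poissonKernel_nonneg hε E))]
    exact ENNReal.ofReal_le_ofReal (hS E hE)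
  refine ENNReal.toReal_le_of_le_ofReal (integral_nonneg hh_nonneg) ?_
  calc μ S ≤ μ {x | 1 ≤ ∫⁻ E in D, ENNReal.ofReal (poissonKernel ε E x)} :=
        measure_mono fun x hx =>
          one_le_setLIntegral_poissonKernel hε (Metric.ball_subset_thickening hx ε)
    _ ≤ ∫⁻ x, (∫⁻ E in D, ENNReal.ofReal (poissonKernel ε E x)) ∂μ := by
        simpa only [div_one] using meas_ge_le_lintegral_div
          (Measurable.lintegral_prod_right hmeas).aemeasurable one_ne_zero ENNReal.one_ne_top
    _ = ∫⁻ E in D, (∫⁻ x, ENNReal.ofReal (poissonKernel ε E x) ∂μ) :=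
        lintegral_lintegral_swap hmeas.aemeasurable
    _ ≤ ∫⁻ E in D, ENNReal.ofReal (h E) := setLIntegral_mono' hD fun _ => hbound
    _ ≤ ∫⁻ E, ENNReal.ofReal (h E) := setLIntegral_le_lintegral _ _
    _ = ENNReal.ofReal (∫ E, h E) :=
        (ofReal_integral_eq_lintegral_ofReal hh (Eventually.of_forall hh_nonneg)).symm

end Poisson

/-! ## Time averages as energy averages -/

section Averages

theorem integrable_interpSum {α : Type*} [MeasurableSpace α] {μ : Measure α} {f : ℕ → α → ℝ}
    (hf : ∀ n, Integrable (f n) μ) (x : ℝ) : Integrable (fun t => interpSum (fun n => f n t) x) μ :=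
  (integrable_finsetSum _ fun n _ => hf n).add ((hf _).const_mul _)

theorem integral_interpSum {α : Type*} [MeasurableSpace α] {μ : Measure α} {f : ℕ → α → ℝ}
    (hf : ∀ n, Integrable (f n) μ) (x : ℝ) :
    ∫ t, interpSum (fun n => f n t) x ∂μ = interpSum (fun n => ∫ t, f n t ∂μ) x := by
  simp only [interpSum]
  rw [integral_add (integrable_finsetSum _ fun n _ => hf n) ((hf _).const_mul _),
    integral_finsetSum _ fun n _ => hf n, integral_const_mul]

variable {A : HalfLine →ₗ.[ℂ] HalfLine} {U : ℝ → HalfLine →L[ℂ] HalfLine}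

theorem integrable_truncNormSq_resolventApply (hU : IsUnitaryGroupOf A U) (hA : IsSelfAdjoint A)
    {ε : ℝ} (hε : 0 < ε) (ψ : HalfLine) (L : ℝ) :
    Integrable fun E : ℝ => truncNormSq L (resolventApply A (E + ε * Complex.I) ψ : HalfLine) := by
  simp only [truncNormSq_eq_interpSum, ← inner_site]
  exact integrable_interpSum
    (fun n => hU.integrable_norm_sq_inner_resolventApply hA hε (site n) ψ) L

theorem integral_truncNormSq_resolventApply (hU : IsUnitaryGroupOf A U) (hA : IsSelfAdjoint A)
    {T : ℝ} (hT : 0 < T) (ψ : HalfLine) (L : ℝ) :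
    ∫ E : ℝ, truncNormSq L (resolventApply A (E + (T⁻¹ : ℝ) * Complex.I) ψ : HalfLine)
      = Real.pi * T * timeAvg T fun t => truncNormSq L (U t ψ) := by
  have hε : 0 < T⁻¹ := inv_pos.2 hT
  have hexp (t : ℝ) : Real.exp (-2 * t / T) = Real.exp (-(2 * T⁻¹ * t)) := by
    congr 1
    ring
  simp only [timeAvg, truncNormSq_eq_interpSum, ← inner_site, ← interpSum_const_mul, hexp]
  rw [integral_interpSum fun n => hU.integrable_norm_sq_inner_resolventApply hA hε (site n) ψ,
    integral_interpSum fun n => hU.integrableOn_exp_mul_norm_sq hε (site n) ψ]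
  simp only [hU.integral_norm_sq_inner_resolventApply hA hε, interpSum_const_mul]
  field_simp

end Averages

/-! ## The Green function of the half-line operator -/

section Green

variable {a b : ℕ → ℝ} {z : ℂ}

/-- The vector `(H₊ - z)⁻¹ δ₁`. -/
def greenVec (a b : ℕ → ℝ) (z : ℂ) : HalfLine := resolventApply (halfLineOp a b) z delta1

/-- The vector `(H₊ - z)⁻¹ δ₁`, extended to `n = 0` by the value `-1`. With `a(0) = 1` this boundary
value absorbs the source `δ₁` and makes the sequence a solution on the whole half-line. -/
def greenSeq (a b : ℕ → ℝ) (z : ℂ) : ℕ → ℂ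
  | 0 => -1
  | n + 1 => ext (greenVec a b z) (n + 1)

theorem interpSum_norm_sq_greenSeq (a b : ℕ → ℝ) (z : ℂ) (L : ℝ) :
    interpSum (fun n => ‖greenSeq a b z n‖ ^ 2) L = truncNormSq L (greenVec a b z) := by
  rw [truncNormSq_eq_interpSum, interpSum, interpSum]
  congr 1
  refine Finset.sum_congr rfl fun n hn => ?_
  obtain ⟨k, rfl⟩ := Nat.exists_eq_add_of_le' (Finset.mem_Icc.1 hn).1
  rfl

theorem sq_norm_greenSeq_one_add_two_le (a b : ℕ → ℝ) (z : ℂ) :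
    ‖greenSeq a b z 1‖ ^ 2 + ‖greenSeq a b z 2‖ ^ 2 ≤ ‖greenVec a b z‖ ^ 2 := by
  simpa [Finset.sum_range_succ] using! sum_le_hasSum (Finset.range 2)
    (fun k _ => sq_nonneg _) (hasSum_norm_sq_ext_succ (greenVec a b z))

theorem isSolution_greenSeq (hA : IsSelfAdjoint (halfLineOp a b)) (ha0 : a 0 = 1)
    (hz : z.im ≠ 0) : IsSolution a b z (greenSeq a b z) := by
  intro n
  have hgraph := mem_graph_halfLineOp.1 (mem_graph_resolventApply hA hz delta1) n.succPNat
  have hdelta : ext delta1 (n + 1) = if n = 0 then 1 else 0 := by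
    simp [show delta1 = site 1 from rfl, ext_site]
  rw [lp.coeFn_add, ext_add, lp.coeFn_smul, ext_smul, formal, Nat.succPNat_coe,
    Nat.succ_eq_add_one, Nat.add_sub_cancel, hdelta] at hgraph
  cases n with
  | zero =>
    rw [ext_zero, if_pos rfl] at hgraph
    simp only [greenSeq, greenVec, ha0, Complex.ofReal_one]
    linear_combination -hgraph
  | succ k =>
    rw [if_neg k.succ_ne_zero] at hgraph
    simp only [greenSeq, greenVec]
    linear_combination -hgraph

theorem im_greenSeq_one (hA : IsSelfAdjoint (halfLineOp a b)) (hz : z.im ≠ 0) :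
    (greenSeq a b z 1).im = z.im * ‖greenVec a b z‖ ^ 2 := by
  rw [greenSeq, ← inner_delta1]
  exact im_inner_of_mem_graph (isFormalAdjoint_self hA) (mem_graph_resolventApply hA hz delta1)

theorem flux_greenSeq_zero (hA : IsSelfAdjoint (halfLineOp a b)) (ha0 : a 0 = 1) (hz : z.im ≠ 0) :
    flux a (greenSeq a b z) 0 = -(z.im * ‖greenVec a b z‖ ^ 2) := by
  rw [← im_greenSeq_one hA hz]
  simp [flux, ha0, greenSeq]

theorem greenSeq_one_ne_zero (hA : IsSelfAdjoint (halfLineOp a b)) (ha0 : a 0 = 1)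
    (hz : z.im ≠ 0) : greenSeq a b z 1 ≠ 0 := by
  intro hzero
  have him := im_greenSeq_one hA hz
  have hvec : greenVec a b z = 0 := by simpa [hzero, hz] using him.symm
  have htwo : greenSeq a b z 2 = 0 := by simp [greenSeq, hvec, ext]
  have hbdry : greenSeq a b z 0 = -1 := rfl
  have hsol : a 1 * greenSeq a b z 2 + a 0 * greenSeq a b z 0 + b 1 * greenSeq a b z 1
      = z * greenSeq a b z 1 := isSolution_greenSeq hA ha0 hz 0
  simp [hzero, htwo, hbdry, ha0] at hsol

theorem truncNormSq_greenVec_pos (hA : IsSelfAdjoint (halfLineOp a b)) (ha0 : a 0 = 1)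
    (hz : z.im ≠ 0) {L : ℝ} (hL : 0 < L) : 0 < truncNormSq L (greenVec a b z) := by
  rw [← interpSum_norm_sq_greenSeq]
  have hle := interpSum_add_mul_le (f := fun n => ‖greenSeq a b z n‖ ^ 2) (fun n => sq_nonneg _)
    le_rfl hL.le
  refine lt_of_lt_of_le ?_ hle
  have hone := norm_pos_iff.2 (greenSeq_one_ne_zero hA ha0 hz)
  have hmin : 0 < min L 1 := lt_min hL one_pos
  simpa [interpSum] using mul_pos hmin (pow_pos hone 2)

theorem integral_poissonKernel_muPlus (hA : IsSelfAdjoint (halfLineOp a b)) {ε : ℝ} (hε : 0 < ε)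
    (E : ℝ) : ∫ x, poissonKernel ε E x ∂muPlus a b
      = ε * ‖greenVec a b (E + ε * Complex.I)‖ ^ 2 := by
  have hμ : IsSpectralMeasure (halfLineOp a b) delta1 (muPlus a b) :=
    isSpectralMeasure_spectralMeasure hA delta1
  have := hμ.finite
  have him : ((E : ℂ) + ε * Complex.I).im = ε := by simp
  have hne : ((E : ℂ) + ε * Complex.I).im ≠ 0 := him.trans_ne hε.ne'
  rw [← im_integral_inv_sub hε, ← hμ.transform _ hne, borelTransform, inner_delta1]
  exact (im_greenSeq_one hA hne).trans (by rw [him])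

theorem integral_poissonKernel_muPlus_le (ha : ∀ n, a n ≠ 0) (ha0 : a 0 = 1)
    (hsum : ¬ Summable fun n : ℕ => |a (n + 1)|⁻¹) {ε L x E : ℝ} (hε : 0 < ε)
    (hx : scaleTilde a b ε x ≤ L) (hE : |E - x| ≤ ε) :
    ∫ y, poissonKernel ε E y ∂muPlus a b
      ≤ 8 * ε * truncNormSq L (greenVec a b (E + ε * Complex.I)) := by
  have hA : IsSelfAdjoint (halfLineOp a b) := isSelfAdjoint_halfLineOp hsum
  set z : ℂ := E + ε * Complex.I
  have him : z.im = ε := by simp [z]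
  have hne : z.im ≠ 0 := him.trans_ne hε.ne'
  obtain ⟨hscale, hΦ⟩ := scaleTilde_spec (b := b) ha ha0 hsum x hε
  have hzx : ‖z - x‖ ^ 2 ≤ 2 * ε ^ 2 := by
    have hsq : (E - x) ^ 2 ≤ ε ^ 2 := sq_le_sq' (abs_le.1 hE).1 (abs_le.1 hE).2
    rw [Complex.sq_norm, Complex.normSq_apply]
    simp only [z, Complex.sub_re, Complex.add_re, Complex.sub_im, Complex.add_im, Complex.ofReal_re,
      Complex.ofReal_im, Complex.re_ofReal_mul, Complex.im_ofReal_mul, Complex.I_re, Complex.I_im]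
    linarith
  have hflux := flux_greenSeq_zero hA ha0 hne
  rw [him] at hflux
  have hmass : ‖greenVec a b z‖ ^ 2 / 8 ≤ truncNormSq L (greenVec a b z) := by
    rw [← interpSum_norm_sq_greenSeq]
    exact (le_interpSum_of_transferNorm_eq ha ha0 hε him hzx (isSolution_greenSeq hA ha0 hne) hflux
      (sq_norm_greenSeq_one_add_two_le a b z) hscale hΦ).trans
      (interpSum_mono (fun _ => sq_nonneg _) (by linarith) hx)
  rw [integral_poissonKernel_muPlus hA hε]
  nlinarith

theorem timeAvg_truncNormSq_expNegI_eq (hA : IsSelfAdjoint (halfLineOp a b)) {T : ℝ} (hT : 0 < T)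
    (L : ℝ) : Real.pi * T * timeAvg T (fun t => truncNormSq L (expNegI (halfLineOp a b) t delta1))
      = ∫ E : ℝ, truncNormSq L (greenVec a b (E + (T⁻¹ : ℝ) * Complex.I)) :=
  (integral_truncNormSq_resolventApply (isUnitaryGroupOf_expNegI hA) hA hT delta1 L).symm

theorem integrable_truncNormSq_greenVec (hA : IsSelfAdjoint (halfLineOp a b)) {ε : ℝ} (hε : 0 < ε)
    (L : ℝ) : Integrable fun E : ℝ => truncNormSq L (greenVec a b (E + ε * Complex.I)) :=
  integrable_truncNormSq_resolventApply (isUnitaryGroupOf_expNegI hA) hA hε delta1 L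

theorem integral_truncNormSq_greenVec_pos (hA : IsSelfAdjoint (halfLineOp a b)) (ha0 : a 0 = 1)
    {ε : ℝ} (hε : 0 < ε) {L : ℝ} (hL : 0 < L) :
    0 < ∫ E : ℝ, truncNormSq L (greenVec a b (E + ε * Complex.I)) := by
  have hpos (E : ℝ) : 0 < truncNormSq L (greenVec a b (E + ε * Complex.I)) :=
    truncNormSq_greenVec_pos hA ha0 (by simp [hε.ne']) hL
  rw [integral_pos_iff_support_of_nonneg (fun E => (hpos E).le)
    (integrable_truncNormSq_greenVec hA hε L)]
  simp [Function.support_eq_univ fun E => (hpos E).ne']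

theorem measureReal_scaleTilde_le_le (ha : ∀ n, a n ≠ 0) (ha0 : a 0 = 1)
    (hsum : ¬ Summable fun n : ℕ => |a (n + 1)|⁻¹) {ε L : ℝ} (hε : 0 < ε) (hL : 0 < L) :
    (muPlus a b).real {E : ℝ | scaleTilde a b ε E ≤ L}
      ≤ 8 * ε * ∫ E : ℝ, truncNormSq L (greenVec a b (E + ε * Complex.I)) := by
  have hA : IsSelfAdjoint (halfLineOp a b) := isSelfAdjoint_halfLineOp hsum
  have : IsFiniteMeasure (muPlus a b) := (isSpectralMeasure_spectralMeasure hA delta1).finite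
  rw [← integral_const_mul]
  refine measureReal_le_integral_of_poissonKernel_le hε
    ((integrable_truncNormSq_greenVec hA hε L).const_mul _) (fun E => ?_) fun E hE => ?_
  · exact mul_nonneg (by positivity)
      (truncNormSq_greenVec_pos hA ha0 (by simp [hε.ne']) hL).le
  · obtain ⟨x, hx, hEx⟩ := Metric.mem_thickening_iff.1 hE
    exact integral_poissonKernel_muPlus_le ha ha0 hsum hε hx hEx.le

end Green

end JacobiDyn

end

theorem corollary1p2_general {a b : ℕ → ℝ} (ha : ∀ n, a n ≠ 0) (ha0 : a 0 = 1)
    (hsum : ¬ Summable fun n : ℕ => |a (n + 1)|⁻¹) {T L : ℝ} (hT : 0 < T) (hL : 0 < L) :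
    1 / (16 * Real.pi) *
        (JacobiDyn.muPlus a b).real {E : ℝ | JacobiDyn.scaleTilde a b T⁻¹ E ≤ L} <
      JacobiDyn.timeAvg T fun t =>
        JacobiDyn.truncNormSq L
          (JacobiDyn.expNegI (JacobiDyn.halfLineOp a b) t JacobiDyn.delta1) := by
  have hA : IsSelfAdjoint (JacobiDyn.halfLineOp a b) := JacobiDyn.isSelfAdjoint_halfLineOp hsum
  have hε : 0 < T⁻¹ := inv_pos.2 hT
  have hmeasure := JacobiDyn.measureReal_scaleTilde_le_le (b := b) ha ha0 hsum hε hL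
  have hpos := JacobiDyn.integral_truncNormSq_greenVec_pos hA ha0 hε hL
  rw [← JacobiDyn.timeAvg_truncNormSq_expNegI_eq hA hT] at hmeasure hpos
  set M := JacobiDyn.timeAvg T fun t =>
    JacobiDyn.truncNormSq L (JacobiDyn.expNegI (JacobiDyn.halfLineOp a b) t JacobiDyn.delta1)
  have hM : 0 < M := pos_of_mul_pos_right hpos (by positivity)
  calc 1 / (16 * Real.pi) * (JacobiDyn.muPlus a b).real {E | JacobiDyn.scaleTilde a b T⁻¹ E ≤ L}
      ≤ 1 / (16 * Real.pi) * (8 * T⁻¹ * (Real.pi * T * M)) := by gcongr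
    _ = M / 2 := by
        field_simp
        norm_num
    _ < M := half_lt_self hM

theorem corollary1p2 :
    ∃ C : ℝ, 0 < C ∧
      ∀ a b : ℕ → ℝ, (∀ n, a n ≠ 0) → a 0 = 1 → (¬ Summable fun n : ℕ => |a (n + 1)|⁻¹) →
        ∀ T L : ℝ, 0 < T → 2 ≤ L →
          C * (JacobiDyn.muPlus a b).real {E : ℝ | JacobiDyn.scaleTilde a b T⁻¹ E ≤ L} <
            JacobiDyn.timeAvg T fun t =>
              JacobiDyn.truncNormSq L
                (JacobiDyn.expNegI (JacobiDyn.halfLineOp a b) t JacobiDyn.delta1) :=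
  ⟨1 / (16 * Real.pi), by positivity, fun _ _ ha ha0 hsum _ _ hT hL =>
    corollary1p2_general ha ha0 hsum hT (by linarith)⟩
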